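/- Let $k$ be a countable (finite or countably infinite) field, let $n\geq 2$, and let $\mathbb K=k(x_1,\dots,x_n)$ be the field of rational functions in $n$ independent indeterminates over $k$. Let $\operatorname{ZR}(\mathbb K)$ be the set of (Krull) valuations $\nu$ on $\mathbb K$, written additively with values in totally ordered abelian groups together with $\infty$, where two valuations are identified when they have the same valuation ring. The Zariski topology on $\operatorname{ZR}(\mathbb K)$ is generated by the sets $\{\nu\mid \nu(x)\geq 0\}$, $x\in\mathbb K$, and the Patch topology is generated by the sets $\{\nu\mid \nu(x)\geq 0\}$ and $\{\nu\mid\nu(x)>0\}$, $x\in\mathbb K$. Let $\operatorname{ZR}(\mathbb K/k)^{k}\subset\operatorname{ZR}(\mathbb K)$ be the set of $k$-rational valuations, that is, of the valuations $\nu$ such that $\nu(c)=0$ for all $c\in k\setminus\{0\}$ and such that the canonical embedding of $k$ into the residue field of $\nu$ is an isomorphism; it carries the subspace topologies. Then $\operatorname{ZR}(\mathbb K/k)^{k}$ with the Patch topology is totally disconnected, perfect (it has no isolated points) and metrizable. Moreover, if $k$ is finite, then $\operatorname{ZR}(\mathbb K/k)^{k}$ is a Cantor set (that is, it is homeomorphic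 to the ternary Cantor set) both for the Patch topology and for the Zariski topology. -/

import Mathlib

/-- The Zariski-Riemann space of a field `K`: valuations on `K` up to equivalence, two valuations
being equivalent when they have the same valuation ring. A class is recorded by its valuation ring,
and `A.valuation` is the canonical valuation in the class of `A`. Mathlib writes valuations
multiplicatively, so that `ν(x) ≥ 0` reads `A.valuation x ≤ 1`, and `ν(x) > 0` reads
`A.valuation x < 1`. -/
abbrev ZariskiRiemann (K : Type*) [Field K] : Type _ := ValuationSubring K

namespace ZariskiRiemann

/-- The point of the Zariski-Riemann space given by an arbitrary valuation. -/
abbrev ofValuation {K : Type*} [Field K] {Γ : Type*} [LinearOrderedCommGroupWithZero Γ]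
    (v : Valuation K Γ) : ZariskiRiemann K := v.valuationSubring

/-- `nonnegSet x` is the set of the `ν` with `ν(x) ≥ 0` (additive notation). -/
def nonnegSet {K : Type*} [Field K] (x : K) : Set (ZariskiRiemann K) :=
  {A | A.valuation x ≤ 1}

/-- `posSet x` is the set of the `ν` with `ν(x) > 0` (additive notation). -/
def posSet {K : Type*} [Field K] (x : K) : Set (ZariskiRiemann K) :=
  {A | A.valuation x < 1}

/-- `nonnegSet` can be read off from any valuation in the class. -/
theorem ofValuation_mem_nonnegSet {K : Type*} [Field K] {Γ : Type*}
    [LinearOrderedCommGroupWithZero Γ] (v : Valuation K Γ) (x : K) :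
    ofValuation v ∈ nonnegSet x ↔ v x ≤ 1 :=
  v.isEquiv_valuation_valuationSubring.le_one_iff_le_one.symm

/-- `posSet` can be read off from any valuation in the class. -/
theorem ofValuation_mem_posSet {K : Type*} [Field K] {Γ : Type*}
    [LinearOrderedCommGroupWithZero Γ] (v : Valuation K Γ) (x : K) :
    ofValuation v ∈ posSet x ↔ v x < 1 :=
  v.isEquiv_valuation_valuationSubring.lt_one_iff_lt_one.symm

/-- The Zariski topology, generated by the sets `ν(x) ≥ 0`. -/
abbrev zariskiTopology (K : Type*) [Field K] : TopologicalSpace (ZariskiRiemann K) :=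
  TopologicalSpace.generateFrom (Set.range nonnegSet)

/-- The Patch topology, generated by the sets `ν(x) ≥ 0` and the sets `ν(x) > 0`. -/
abbrev patchTopology (K : Type*) [Field K] : TopologicalSpace (ZariskiRiemann K) :=
  TopologicalSpace.generateFrom (Set.range nonnegSet ∪ Set.range posSet)

/-- The valuations on `K` that are trivial on the subfield `k`. -/
def relative (k K : Type*) [Field k] [Field K] [Algebra k K] : Set (ZariskiRiemann K) :=
  {A | ∀ c : k, c ≠ 0 → A.valuation (algebraMap k K c) = 1}

theorem algebraMap_mem {k K : Type*} [Field k] [Field K] [Algebra k K] {A : ZariskiRiemann K}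
    (hA : A ∈ relative k K) (c : k) : algebraMap k K c ∈ A.toSubring := by
  rcases eq_or_ne c 0 with rfl | hc
  · simp
  · exact A.mem_of_valuation_le_one _ (hA c hc).le

/-- The canonical embedding of `k` into the residue field of a valuation trivial on `k`. -/
noncomputable def residueEmbedding {k K : Type*} [Field k] [Field K] [Algebra k K] (A : ZariskiRiemann K)
    (hA : A ∈ relative k K) : k →+* IsLocalRing.ResidueField A :=
  (IsLocalRing.residue A).comp ((algebraMap k K).codRestrict A.toSubring (algebraMap_mem hA))

/-- The `k`-rational valuations on `K`: those that are trivial on `k` and have residue field `k`. -/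
def rational (k K : Type*) [Field k] [Field K] [Algebra k K] : Set (ZariskiRiemann K) :=
  {A | ∃ hA : A ∈ relative k K, Function.Bijective (residueEmbedding A hA)}

/-- The subspace topology on the rational valuations induced by the Zariski topology. -/
abbrev rationalZariski (k K : Type*) [Field k] [Field K] [Algebra k K] :
    TopologicalSpace (rational k K) :=
  TopologicalSpace.induced Subtype.val (zariskiTopology K)

/-- The subspace topology on the rational valuations induced by the Patch topology. -/
abbrev rationalPatch (k K : Type*) [Field k] [Field K] [Algebra k K] :
    TopologicalSpace (rational k K) :=
  TopologicalSpace.induced Subtype.val (patchTopology K)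

end ZariskiRiemann

/-- A topological space is a Cantor set if it is homeomorphic to the ternary Cantor set. -/
def IsCantorSpace (X : Type*) (t : TopologicalSpace X) : Prop :=
  Nonempty (X ≃ₜ cantorSet)

/-- The field `k(x₁, …, xₙ)` of rational functions in `n` indeterminates. -/
abbrev RationalFunctionField (k : Type*) [Field k] (n : ℕ) : Type _ :=
  FractionRing (MvPolynomial (Fin n) k)

/-! Sending a valuation ring to its membership function embeds the Patch topology into `K → Bool`
(`isEmbedding_indicator`). Total disconnectedness follows, and so does metrizability, since `K` is
countable. Over a finite `k`, being rational is a closed condition on membership functions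
(`range_indicator_eq`), so the space is compact. Moreover `ν(x) > 0` then only excludes finitely
many nonzero residues, so the two topologies agree. A rational valuation exists because `k((t))`
contains `n` algebraically independent elements. Brouwer's characterization gives the Cantor set
once no point is isolated.

The absence of isolated points is the heart of the matter. Since `n ≥ 2`, one has `K = L(x)` with
`x` transcendental over some `L ≠ k`. Given a rational valuation and finitely many elements
`P(x)/Q(x)` of its maximal ideal, extend the valuation to `v` on an algebraic closure `M` of `K`,
and then to `W` on `M(u)`, where `u` has a value infinitesimally less than `1` in multiplicative
notation. The point `x` is replaced by `y = a + c u` with `a` algebraic over `L`, and `W` is pulled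
back along `x ↦ y`.

Strict inequalities survive: factoring over `M`, the value of a polynomial at `x` is a monomial in
`v (x - a)`, and its value at `y` is the same monomial in `W (c u)`, provided `v c` lies in a
suitable interval (`exists_bound_of_lt`). The residue field stays `k`: distinct powers of `c u` are
incommensurable with the divisible value group of `M`, so dominant terms reduce the question to
`L(a)`, and `a` of minimal degree among good approximations of `x` makes the residue field of `L(a)`
equal to `k` (`exists_isAlgebraic_approximation`). Two choices of `c` separated by the value of an
algebraic element yield two different valuations, so one of them differs from the given one. -/

namespace CantorCoding

/-! ### Coding a compact perfect space by binary sequences. -/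

variable {X : Type*}

/-- The set `S` divides `C` into two nonempty parts. -/
def Divides (S C : Set X) : Prop := (C ∩ S).Nonempty ∧ (C \ S).Nonempty

open Classical in
/-- A member of the family `U` dividing `C`, the `n`-th one if possible. -/
noncomputable def divider (U : ℕ → Set X) (n : ℕ) (C : Set X) : Set X :=
  if Divides (U n) C then U n else if h : ∃ m, Divides (U m) C then U h.choose else ∅

open Classical in
/-- The cell of `x` after `n` divisions of the whole space. -/
noncomputable def cell (U : ℕ → Set X) (x : X) : ℕ → Set X
  | 0 => Set.univ
  | n + 1 => if x ∈ divider U n (cell U x n) then cell U x n ∩ divider U n (cell U x n)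
      else cell U x n \ divider U n (cell U x n)

open Classical in
/-- The binary sequence which records the side of each division on which `x` lies. -/
noncomputable def code (U : ℕ → Set X) (x : X) (n : ℕ) : Bool :=
  decide (x ∈ divider U n (cell U x n))

variable {U : ℕ → Set X}

theorem divides_divider {C : Set X} (h : ∃ m, Divides (U m) C) (n : ℕ) :
    Divides (divider U n C) C := by
  unfold divider
  split_ifs with h1
  · exact h1
  · exact h.choose_spec

theorem isClopen_divider [TopologicalSpace X] (hU : ∀ n, IsClopen (U n)) (n : ℕ) (C : Set X) :
    IsClopen (divider U n C) := by
  unfold divider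
  split_ifs with h1 h2
  · exact hU n
  · exact hU _
  · exact isClopen_empty

theorem mem_cell (x : X) (n : ℕ) : x ∈ cell U x n := by
  induction n with
  | zero => trivial
  | succ n ih =>
    rw [cell]
    split_ifs with h
    · exact ⟨ih, h⟩
    · exact ⟨ih, h⟩

theorem isClopen_cell [TopologicalSpace X] (hU : ∀ n, IsClopen (U n)) (x : X) (n : ℕ) :
    IsClopen (cell U x n) := by
  induction n with
  | zero => exact isClopen_univ
  | succ n ih =>
    rw [cell]
    split_ifs with h
    · exact ih.inter (isClopen_divider hU _ _)
    · exact ih.diff (isClopen_divider hU _ _)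

theorem mem_cell_succ_iff {x y : X} {n : ℕ} : y ∈ cell U x (n + 1) ↔
    y ∈ cell U x n ∧ (y ∈ divider U n (cell U x n) ↔ x ∈ divider U n (cell U x n)) := by
  rw [cell]
  split_ifs with h <;> simp [h]

/-- The cells of a given level partition the space, because the divider depends on the cell only and
not on the point. -/
theorem cell_eq_of_mem {x y : X} {n : ℕ} (h : y ∈ cell U x n) : cell U y n = cell U x n := by
  induction n with
  | zero => rfl
  | succ n ih =>
    have h' := mem_cell_succ_iff.1 h
    ext z
    rw [mem_cell_succ_iff, mem_cell_succ_iff, ih h'.1, h'.2]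

theorem mem_cell_iff {x y : X} {n : ℕ} :
    y ∈ cell U x n ↔ ∀ i < n, code U y i = code U x i := by
  induction n with
  | zero => simp [cell]
  | succ n ih =>
    rw [mem_cell_succ_iff, Nat.forall_lt_succ_right, ← ih]
    refine and_congr_right fun h => ?_
    rw [code, code, cell_eq_of_mem h, decide_eq_decide]

theorem continuous_code [TopologicalSpace X] (hU : ∀ n, IsClopen (U n)) :
    Continuous (code U) := by
  refine continuous_pi fun n => IsLocallyConstant.continuous ?_
  rw [IsLocallyConstant.iff_exists_open]
  exact fun x => ⟨cell U x (n + 1), (isClopen_cell hU x _).isOpen, mem_cell x _,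
    fun y hy => mem_cell_iff.1 hy n n.lt_succ_self⟩

/-- Stage `n` gives priority to `U n`: either it is used there, or it did not divide the cell
anyway. This makes the code injective. -/
theorem mem_iff_of_mem_cell {x y : X} {n : ℕ} (h : y ∈ cell U x (n + 1)) :
    y ∈ U n ↔ x ∈ U n := by
  have h' := mem_cell_succ_iff.1 h
  by_cases hd : Divides (U n) (cell U x n)
  · have : divider U n (cell U x n) = U n := if_pos hd
    rw [this] at h'
    exact h'.2
  · by_contra hne
    refine hd ?_
    have hx := mem_cell (U := U) x n
    by_cases hxU : x ∈ U n
    · exact ⟨⟨x, hx, hxU⟩, ⟨y, h'.1, fun hy => hne (iff_of_true hy hxU)⟩⟩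
    · exact ⟨⟨y, h'.1, by_contra fun hy => hne (iff_of_false hy hxU)⟩, ⟨x, hx, hxU⟩⟩

theorem injective_code (hsep : ∀ x y, (∀ n, x ∈ U n ↔ y ∈ U n) → x = y) :
    Function.Injective (code U) := fun x y h =>
  hsep x y fun _ => mem_iff_of_mem_cell (mem_cell_iff.2 fun i _ => congrFun h i)

/-- An open cell has at least two points, and some `U m` separates them. -/
theorem exists_divides [TopologicalSpace X] [PerfectSpace X]
    (hsep : ∀ x y, (∀ n, x ∈ U n ↔ y ∈ U n) → x = y) {C : Set X} (hC : IsOpen C)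
    (hne : C.Nonempty) : ∃ m, Divides (U m) C := by
  obtain ⟨x, hx⟩ := hne
  have := perfectSpace_iff_forall_not_isolated.1 ‹PerfectSpace X› x
  obtain ⟨y, hyC, hyx⟩ := Filter.nonempty_of_mem
    (inter_mem_nhdsWithin ({x}ᶜ : Set X) (hC.mem_nhds hx))
  by_contra! hd
  refine hyC (hsep y x fun n => ?_)
  have := hd n
  by_contra hne
  refine this ?_
  by_cases hxU : x ∈ U n
  · exact ⟨⟨x, hx, hxU⟩, ⟨y, hyx, fun hy => hne (iff_of_true hy hxU)⟩⟩
  · exact ⟨⟨y, hyx, by_contra fun hy => hne (iff_of_false hy hxU)⟩, ⟨x, hx, hxU⟩⟩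

/-- Every cell is genuinely divided at every stage, so each finite binary word is realized;
compactness passes to infinite sequences. -/
theorem surjective_code [TopologicalSpace X] [CompactSpace X] [PerfectSpace X] [Nonempty X]
    (hU : ∀ n, IsClopen (U n)) (hsep : ∀ x y, (∀ n, x ∈ U n ↔ y ∈ U n) → x = y) :
    Function.Surjective (code U) := by
  intro σ
  have key : ∀ n, {x | ∀ i < n, code U x i = σ i}.Nonempty := by
    intro n
    induction n with
    | zero => exact ⟨Classical.arbitrary X, by simp⟩
    | succ n ih =>
      obtain ⟨x, hx⟩ := ih
      have hd := divides_divider (exists_divides hsep (isClopen_cell hU x n).isOpen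
        ⟨x, mem_cell x n⟩) n
      obtain ⟨y, hy, hyn⟩ : ∃ y ∈ cell U x n, code U y n = σ n := by
        cases hσ : σ n
        · obtain ⟨y, hy, hy'⟩ := hd.2
          exact ⟨y, hy, by simpa [code, cell_eq_of_mem hy] using hy'⟩
        · obtain ⟨y, hy, hy'⟩ := hd.1
          exact ⟨y, hy, by simpa [code, cell_eq_of_mem hy] using hy'⟩
      refine ⟨y, Nat.forall_lt_succ_right.2 ⟨fun i hi => ?_, hyn⟩⟩
      rw [mem_cell_iff.1 hy i hi, hx i hi]
  have hclosed : ∀ n, IsClosed {x | ∀ i < n, code U x i = σ i} := by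
    intro n
    simp only [Set.ofPred_forall]
    exact isClosed_iInter fun i => isClosed_iInter fun _ => isClosed_eq
      ((continuous_apply i).comp (continuous_code hU)) continuous_const
  have hanti : ∀ n, {x | ∀ i < n + 1, code U x i = σ i} ⊆ {x | ∀ i < n, code U x i = σ i} :=
    fun n => Set.ofPred_subset_ofPred.2 fun x hx i hi => hx i (hi.trans n.lt_succ_self)
  obtain ⟨x, hx⟩ := IsCompact.nonempty_iInter_of_sequence_nonempty_isCompact_isClosed _
    hanti key (hclosed 0).isCompact hclosed
  exact ⟨x, funext fun i => Set.mem_iInter.1 hx (i + 1) i i.lt_succ_self⟩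

end CantorCoding

/-- Brouwer's characterization of the Cantor set: a nonempty compact perfect space whose points
are separated by countably many clopen sets is a Cantor set. -/
theorem isCantorSpace_of_clopen_separating {X : Type*} [t : TopologicalSpace X] [CompactSpace X]
    [PerfectSpace X] [Nonempty X] (U : ℕ → Set X) (hU : ∀ n, IsClopen (U n))
    (hsep : ∀ x y, (∀ n, x ∈ U n ↔ y ∈ U n) → x = y) : IsCantorSpace X t :=
  ⟨((CantorCoding.continuous_code hU).homeoOfEquivCompactToT2
    (f := Equiv.ofBijective _ ⟨CantorCoding.injective_code hsep,
      CantorCoding.surjective_code hU hsep⟩)).trans cantorSetHomeomorphNatToBool.symm⟩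

/-! ### Rational valuations and the Patch topology. -/

namespace ZariskiRiemann

section Rational

variable {k K : Type*} [Field k] [Field K] [Algebra k K]

theorem mem_relative_iff {A : ZariskiRiemann K} :
    A ∈ relative k K ↔ ∀ c : k, algebraMap k K c ∈ A := by
  refine ⟨fun hA c => algebraMap_mem hA c, fun h c hc => ?_⟩
  refine le_antisymm ((A.valuation_le_one_iff _).2 (h c)) ?_
  have h1 := (A.valuation_le_one_iff _).2 (h c⁻¹)
  rw [map_inv₀, map_inv₀] at h1
  have h0 : A.valuation (algebraMap k K c) ≠ 0 := by simpa using hc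
  rwa [inv_le_one₀ (zero_lt_iff.2 h0)] at h1

/-- A valuation is `k`-rational when its ring contains `k` and each of its elements is congruent to
a constant modulo the maximal ideal. -/
theorem mem_rational_iff {A : ZariskiRiemann K} :
    A ∈ rational k K ↔ (∀ c : k, algebraMap k K c ∈ A) ∧
      ∀ f ∈ A, ∃ c : k, A.valuation (f - algebraMap k K c) < 1 := by
  have key : ∀ (hA : A ∈ relative k K) (f : A) (c : k),
      residueEmbedding A hA c = IsLocalRing.residue A f ↔
        A.valuation (f - algebraMap k K c) < 1 := by
    intro hA f c
    have : (f : K) - algebraMap k K c = ((f - ⟨_, algebraMap_mem hA c⟩ : A) : K) := rfl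
    rw [this, ← A.valuation_lt_one_iff, ← IsLocalRing.residue_eq_zero_iff, map_sub, sub_eq_zero,
      eq_comm]
    rfl
  constructor
  · rintro ⟨hA, hbij⟩
    refine ⟨mem_relative_iff.1 hA, fun f hf => ?_⟩
    obtain ⟨c, hc⟩ := hbij.2 (IsLocalRing.residue A ⟨f, hf⟩)
    exact ⟨c, (key hA ⟨f, hf⟩ c).1 hc⟩
  · rintro ⟨h1, h2⟩
    have hA := mem_relative_iff.2 h1
    refine ⟨hA, RingHom.injective _, fun r => ?_⟩
    obtain ⟨f, rfl⟩ := IsLocalRing.residue_surjective r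
    obtain ⟨c, hc⟩ := h2 f f.2
    exact ⟨c, (key hA f c).2 hc⟩

theorem valuation_algebraMap_eq_one {A : ZariskiRiemann K} (hA : A ∈ rational k K) {c : k}
    (hc : c ≠ 0) : A.valuation (algebraMap k K c) = 1 :=
  hA.1 c hc

/-- Rationality passes to the preimage under a `k`-embedding. -/
theorem comap_mem_rational {K' : Type*} [Field K'] [Algebra k K'] {B : ZariskiRiemann K'}
    (φ : K →ₐ[k] K') (h1 : ∀ c : k, algebraMap k K' c ∈ B)
    (h2 : ∀ f : K, φ f ∈ B → ∃ c : k, B.valuation (φ f - algebraMap k K' c) < 1) :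
    (B.comap φ.toRingHom : ZariskiRiemann K) ∈ rational k K := by
  refine mem_rational_iff.2 ⟨fun c => ?_, fun f hf => ?_⟩
  · simpa [ValuationSubring.mem_comap] using h1 c
  · obtain ⟨c, hc⟩ := h2 f hf
    refine ⟨c, ?_⟩
    rw [← ValuationSubring.mem_nonunits_iff, ValuationSubring.mem_nonunits_iff_or] at hc ⊢
    rw [ValuationSubring.mem_comap]
    have e : φ f - algebraMap k K' c = φ (f - algebraMap k K c) := by rw [map_sub, φ.commutes]
    rw [e, ← map_inv₀] at hc
    exact hc.imp_left fun h0 => (map_eq_zero φ).1 h0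

end Rational

section Patch

variable {K : Type*} [Field K]

open Classical in
/-- The membership function of a valuation ring. -/
noncomputable def indicator (A : ZariskiRiemann K) (x : K) : Bool := decide (x ∈ A)

theorem indicator_eq_true {A : ZariskiRiemann K} {x : K} : indicator A x = true ↔ x ∈ A := by
  simp [indicator]

theorem indicator_injective : Function.Injective (indicator (K := K)) := fun A B h =>
  SetLike.ext fun x => by rw [← indicator_eq_true, h, indicator_eq_true]

theorem posSet_eq {x : K} (hx : x ≠ 0) : posSet x = (nonnegSet x⁻¹)ᶜ := by
  ext A
  rw [posSet, nonnegSet, Set.mem_compl_iff, Set.mem_ofPred_eq, Set.mem_ofPred_eq,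
    A.valuation_le_one_iff,
    ← ValuationSubring.mem_nonunits_iff, ValuationSubring.mem_nonunits_iff_or, or_iff_right hx]

theorem posSet_zero : posSet (0 : K) = Set.univ := by
  ext A
  simp [posSet]

theorem nonnegSet_eq_preimage (x : K) :
    nonnegSet x = indicator ⁻¹' ((fun σ : K → Bool => σ x) ⁻¹' {true}) := by
  ext A
  simp [nonnegSet, indicator]

/-- Up to the element zero, the positivity sets are the complements of the nonnegativity sets of
inverses, so the Patch topology makes all membership conditions clopen. -/
theorem patchTopology_eq_induced :
    patchTopology K = TopologicalSpace.induced indicator Pi.topologicalSpace := by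
  have hcl : ∀ x : K, @IsClopen _ (TopologicalSpace.induced indicator Pi.topologicalSpace)
      (nonnegSet x) := by
    intro x
    let : TopologicalSpace (ZariskiRiemann K) :=
      TopologicalSpace.induced indicator Pi.topologicalSpace
    rw [nonnegSet_eq_preimage]
    exact (((isClopen_discrete {true}).preimage (continuous_apply x)).preimage
      continuous_induced_dom)
  apply le_antisymm
  · rw [← continuous_iff_le_induced]
    let := patchTopology K
    refine continuous_pi fun x => continuous_discrete_rng.2 fun b => ?_
    have h1 : IsOpen (nonnegSet x) := .basic _ (.inl ⟨x, rfl⟩)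
    cases b
    · have : (fun A : ZariskiRiemann K => indicator A x) ⁻¹' {false} = (nonnegSet x)ᶜ := by
        ext A; simp [nonnegSet, indicator]
      rw [this]
      rcases eq_or_ne x 0 with rfl | hx
      · have : (nonnegSet (0 : K))ᶜ = ∅ := by ext; simp [nonnegSet]
        rw [this]
        exact isOpen_empty
      · have := posSet_eq (inv_ne_zero hx)
        rw [inv_inv] at this
        rw [← this]
        exact .basic _ (.inr ⟨x⁻¹, rfl⟩)
    · convert h1 using 1
      ext A; simp [nonnegSet, indicator]
  · refine TopologicalSpace.le_generateFrom_iff_subset_isOpen.2 ?_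
    rintro _ (⟨x, rfl⟩ | ⟨x, rfl⟩)
    · exact (hcl x).2
    · rcases eq_or_ne x 0 with rfl | hx
      · rw [posSet_zero]
        exact @isOpen_univ _ (TopologicalSpace.induced indicator Pi.topologicalSpace)
      · rw [posSet_eq hx]
        exact (@isOpen_compl_iff _ _ (_)).2 (hcl _).1

end Patch

/-! ### Topology of the space of rational valuations. -/

section Subspace

variable (k K : Type*) [Field k] [Field K] [Algebra k K]

theorem isEmbedding_indicator :
    @Topology.IsEmbedding _ _ (rationalPatch k K) _ fun A : rational k K => indicator A.1 := by
  let := rationalPatch k K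
  refine ⟨⟨?_⟩, indicator_injective.comp Subtype.val_injective⟩
  change TopologicalSpace.induced _ _ = _
  rw [patchTopology_eq_induced, induced_compose]
  rfl

theorem metrizableSpace_rationalPatch [Countable K] :
    @TopologicalSpace.MetrizableSpace _ (rationalPatch k K) := by
  let := rationalPatch k K
  exact (isEmbedding_indicator k K).metrizableSpace

theorem totallyDisconnectedSpace_rationalPatch :
    @TotallyDisconnectedSpace _ (rationalPatch k K) := by
  let := rationalPatch k K
  refine ⟨(isEmbedding_indicator k K).isTotallyDisconnected ?_⟩
  exact isTotallyDisconnected_of_totallyDisconnectedSpace _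

theorem isClopen_mem (x : K) :
    @IsClopen _ (rationalPatch k K) {A : rational k K | x ∈ A.1} := by
  let := rationalPatch k K
  have := ((isClopen_discrete {true}).preimage (continuous_apply x)).preimage
    (isEmbedding_indicator k K).continuous
  convert this using 1
  ext A
  simp [indicator]

variable {k K}

/-- Rationality is spelled out as pointwise conditions on the membership function; the only
existential quantifier ranges over `k`. The alternative `x = algebraMap k K c` is needed because
`0⁻¹ = 0` lies in every ring. -/
theorem range_indicator_eq :
    (Set.range fun A : rational k K => indicator A.1) =
      {σ | (∀ x y, σ x = true → σ y = true → σ (x + y) = true) ∧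
        (∀ x y, σ x = true → σ y = true → σ (x * y) = true) ∧
        (∀ x, σ x = true → σ (-x) = true) ∧
        (∀ x, σ x = true ∨ σ x⁻¹ = true) ∧
        (∀ c : k, σ (algebraMap k K c) = true) ∧
        (∀ x, σ x = true → ∃ c : k, x = algebraMap k K c ∨
          ¬ σ (x - algebraMap k K c)⁻¹ = true)} := by
  have hlt : ∀ (A : ZariskiRiemann K) (x : K) (c : k),
      A.valuation (x - algebraMap k K c) < 1 ↔
        (x = algebraMap k K c ∨ (x - algebraMap k K c)⁻¹ ∉ A) := by
    intro A x c
    rw [← ValuationSubring.mem_nonunits_iff, ValuationSubring.mem_nonunits_iff_or, sub_eq_zero]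
  ext σ
  constructor
  · rintro ⟨⟨A, hA⟩, rfl⟩
    rw [mem_rational_iff] at hA
    simp only [hlt] at hA
    simp only [Set.mem_ofPred_eq, indicator_eq_true]
    exact ⟨fun x y => A.add_mem x y, fun x y => A.mul_mem x y, fun x => A.neg_mem x,
      A.mem_or_inv_mem, hA⟩
  · rintro ⟨hadd, hmul, hneg, hinv, hk, hres⟩
    let A : ZariskiRiemann K :=
      { carrier := {x | σ x = true}
        mul_mem' := fun {x y} => hmul x y
        one_mem' := by simpa using hk 1
        add_mem' := fun {x y} => hadd x y
        zero_mem' := by simpa using hk 0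
        neg_mem' := fun {x} => hneg x
        mem_or_inv_mem' := hinv }
    have hA : ∀ x, x ∈ A ↔ σ x = true := fun x => Iff.rfl
    refine ⟨⟨A, mem_rational_iff.2 ⟨hk, fun x hx => ?_⟩⟩, ?_⟩
    · simp only [hlt, hA]
      exact hres x hx
    · ext x
      rw [Bool.eq_iff_iff, indicator_eq_true, hA]

-- With `k` finite, the existence of a residue is a finite union of closed conditions, so the range
-- of the embedding is closed in a compact product.
variable (k K) in
theorem compactSpace_rationalPatch [Finite k] : @CompactSpace _ (rationalPatch k K) := by
  let := rationalPatch k K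
  have hcl : IsClosed (Set.range fun A : rational k K => indicator A.1) := by
    have h : ∀ x : K, IsClopen {σ : K → Bool | σ x = true} := fun x =>
      (isClopen_discrete {true}).preimage (continuous_apply x)
    rw [range_indicator_eq]
    simp only [imp_iff_not_or, Set.ofPred_and, Set.ofPred_forall, Set.ofPred_or, Set.ofPred_exists]
    refine .inter ?_ (.inter ?_ (.inter ?_ (.inter ?_ (.inter ?_ ?_))))
    · exact isClosed_iInter fun x => isClosed_iInter fun y =>
        (h x).compl.1.union ((h y).compl.1.union (h _).1)
    · exact isClosed_iInter fun x => isClosed_iInter fun y =>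
        (h x).compl.1.union ((h y).compl.1.union (h _).1)
    · exact isClosed_iInter fun x => (h x).compl.1.union (h _).1
    · exact isClosed_iInter fun x => (h x).1.union (h _).1
    · exact isClosed_iInter fun x => (h _).1
    · exact isClosed_iInter fun x => (h x).compl.1.union
        (isClosed_iUnion_of_finite fun c => isClosed_const.union (h _).compl.1)
  rw [← isCompact_univ_iff, (isEmbedding_indicator k K).isCompact_iff, Set.image_univ]
  exact hcl.isCompact

/-- Over a finite field the two topologies agree on the rational valuations. -/
theorem rationalZariski_eq_rationalPatch [Finite k] : rationalZariski k K = rationalPatch k K := by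
  apply le_antisymm
  · rw [rationalPatch, induced_generateFrom_eq]
    refine TopologicalSpace.le_generateFrom_iff_subset_isOpen.2 ?_
    let := rationalZariski k K
    have hopen : ∀ x : K, IsOpen (Subtype.val ⁻¹' nonnegSet x : Set (rational k K)) := fun x =>
      ⟨nonnegSet x, .basic _ ⟨x, rfl⟩, rfl⟩
    rintro _ ⟨_, ⟨x, rfl⟩ | ⟨x, rfl⟩, rfl⟩
    · exact hopen x
    · change IsOpen (Subtype.val ⁻¹' posSet x : Set (rational k K))
      -- If `x` is not a nonzero constant, its residue is zero exactly when `x` is integral and each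
      -- `x - c` with `c ≠ 0` is a unit. Nonzero constants are set apart because the condition at `c
      -- = x` would be vacuous, as `0⁻¹ = 0`.
      by_cases hx : ∃ c : k, c ≠ 0 ∧ algebraMap k K c = x
      · obtain ⟨c, hc, rfl⟩ := hx
        convert isOpen_empty (X := rational k K)
        ext A
        simpa [posSet] using (valuation_algebraMap_eq_one A.2 hc).ge
      · have : (Subtype.val ⁻¹' posSet x : Set (rational k K)) =
            Subtype.val ⁻¹' nonnegSet x ∩
              ⋂ c : {c : k // c ≠ 0}, Subtype.val ⁻¹' nonnegSet (x - algebraMap k K c)⁻¹ := by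
          ext ⟨A, hA⟩
          simp only [Set.mem_preimage, posSet, nonnegSet, Set.mem_ofPred_eq, Set.mem_inter_iff,
            Set.mem_iInter, map_inv₀, Subtype.forall]
          constructor
          · intro h
            refine ⟨h.le, fun c hc => ?_⟩
            have h1 := valuation_algebraMap_eq_one hA hc
            rw [Valuation.map_sub_eq_of_lt_right _ (by rwa [h1]), h1, inv_one]
          · rintro ⟨h1, h2⟩
            obtain ⟨c, hc⟩ := (mem_rational_iff.1 hA).2 x ((A.valuation_le_one_iff x).1 h1)
            rcases eq_or_ne c 0 with rfl | hc0
            · simpa using hc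
            · have h0 : x - algebraMap k K c ≠ 0 := fun h0 =>
                hx ⟨c, hc0, (sub_eq_zero.1 h0).symm⟩
              have h3 := h2 c hc0
              rw [inv_le_one₀ (zero_lt_iff.2 ((Valuation.ne_zero_iff _).2 h0))] at h3
              exact absurd hc h3.not_gt
        rw [this]
        exact (hopen x).inter (isOpen_iInter_of_finite fun c => hopen _)
  · exact induced_mono (TopologicalSpace.generateFrom_anti Set.subset_union_left)

/-- Over a finite field, the rational valuations form a Cantor set as soon as there is one and none
of them is isolated. -/
theorem isCantorSpace_rationalPatch [Finite k] [Countable K] (hne : (rational k K).Nonempty)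
    (hp : @PerfectSpace _ (rationalPatch k K)) :
    IsCantorSpace (rational k K) (rationalPatch k K) := by
  let := rationalPatch k K
  have := compactSpace_rationalPatch k K
  have := hne.to_subtype
  obtain ⟨e, he⟩ := exists_surjective_nat K
  refine isCantorSpace_of_clopen_separating (fun n => {A : rational k K | e n ∈ A.1})
    (fun n => isClopen_mem k K (e n)) fun A B h => Subtype.ext (SetLike.ext fun x => ?_)
  obtain ⟨n, rfl⟩ := he x
  exact h n

/-- A criterion for the absence of isolated points: it suffices to perturb each rational valuation
while keeping finitely many elements in the maximal ideal. -/
theorem perfectSpace_rationalPatch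
    (h : ∀ A ∈ rational k K, ∀ G : Finset K, (∀ g ∈ G, A.valuation g < 1) →
      ∃ B ∈ rational k K, B ≠ A ∧ ∀ g ∈ G, B.valuation g < 1) :
    @PerfectSpace _ (rationalPatch k K) := by
  classical
  let := rationalPatch k K
  refine perfectSpace_iff_forall_not_isolated.2 fun A => ?_
  rw [← mem_closure_iff_nhdsWithin_neBot, mem_closure_iff_nhds_basis
    ((TopologicalSpace.isTopologicalBasis_of_subbasis
      (induced_generateFrom_eq (f := Subtype.val))).nhds_hasBasis)]
  rintro _ ⟨⟨𝒮, ⟨hfin, hsub⟩, rfl⟩, hA⟩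
  -- Integrality of `x` is strengthened to `x - c` being in the maximal ideal, where `c` is the
  -- residue of `x` at `A`.
  have key : ∀ s ∈ 𝒮, ∃ g : K, A.1.valuation g < 1 ∧
      ∀ B : rational k K, B.1.valuation g < 1 → B ∈ s := by
    intro s hs
    have hAs := hA s hs
    obtain ⟨_, ⟨x, rfl⟩ | ⟨x, rfl⟩, rfl⟩ := hsub hs
    · obtain ⟨c, hc⟩ := (mem_rational_iff.1 A.2).2 x ((A.1.valuation_le_one_iff x).1 hAs)
      refine ⟨_, hc, fun B hB => ?_⟩
      have := (mem_rational_iff.1 B.2).1 c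
      rw [← B.1.valuation_le_one_iff] at this
      have h' := B.1.valuation.map_add_le hB.le this
      rwa [sub_add_cancel] at h'
    · exact ⟨x, hAs, fun B hB => hB⟩
  choose! g hg using key
  obtain ⟨B, hB, hne, hBG⟩ := h A.1 A.2 (hfin.toFinset.image g) (by
    simpa using fun s hs => (hg s hs).1)
  refine ⟨⟨B, hB⟩, fun h => hne (congrArg Subtype.val h), fun s hs => (hg s hs).2 _ ?_⟩
  exact hBG _ (Finset.mem_image_of_mem g (hfin.mem_toFinset.2 hs))

end Subspace

end ZariskiRiemann

/-! ### Extension of valuation rings along field embeddings. -/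

namespace ValuationSubring

variable {K M : Type*} [Field K] [Field M]

theorem nonunits_comap (B : ValuationSubring M) (φ : K →+* M) {x : K} :
    (B.comap φ).valuation x < 1 ↔ B.valuation (φ x) < 1 := by
  simp only [← mem_nonunits_iff, mem_nonunits_iff_or, mem_comap, map_inv₀, map_eq_zero]

/-- Every valuation ring extends along an embedding of fields. -/
theorem exists_comap_eq (A : ValuationSubring K) (φ : K →+* M) :
    ∃ B : ValuationSubring M, B.comap φ = A := by
  let ψ : A →+* M := φ.comp A.subtype
  have hψ : Function.Injective ψ := φ.injective.comp A.subtype_injective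
  let e : A ≃+* ψ.range :=
    RingEquiv.ofBijective ψ.rangeRestrict ⟨fun x y h => hψ (congrArg Subtype.val h),
      ψ.rangeRestrict_surjective⟩
  let I : Ideal ψ.range := (IsLocalRing.maximalIdeal A).comap e.symm.toRingHom
  have hI : I ≠ ⊤ := by
    rw [Ne, Ideal.eq_top_iff_one]
    simp [I, Ideal.mem_comap]
  obtain ⟨B, hAB, hIB⟩ := Ideal.image_subset_nonunits_valuationSubring I hI
  have h1 : ∀ x ∈ A, φ x ∈ B := fun x hx => hAB ⟨⟨x, hx⟩, rfl⟩
  have h2 : ∀ x, A.valuation x < 1 → B.valuation (φ x) < 1 := by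
    intro x hx
    have hxA : x ∈ A := (A.valuation_le_one_iff x).1 hx.le
    rw [← mem_nonunits_iff]
    refine hIB ⟨e ⟨x, hxA⟩, ?_, rfl⟩
    change e.symm (e ⟨x, hxA⟩) ∈ IsLocalRing.maximalIdeal A
    rw [e.symm_apply_apply, A.valuation_lt_one_iff]
    exact hx
  refine ⟨B, SetLike.ext fun x => ⟨fun hx => ?_, h1 x⟩⟩
  rw [mem_comap] at hx
  -- An `x` outside `A` has its inverse in the maximal ideal of `A`, hence in that of `B`, which
  -- excludes `φ x ∈ B`.
  by_contra hxA
  have hx0 : x ≠ 0 := by rintro rfl; exact hxA A.zero_mem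
  have := h2 x⁻¹ (by
    rw [← mem_nonunits_iff, inv_mem_nonunits_iff]; exact .inr hxA)
  rw [map_inv₀, ← mem_nonunits_iff, inv_mem_nonunits_iff, map_eq_zero] at this
  exact this.elim hx0 fun h => h hx

end ValuationSubring

/-! ### Adjoining an element of value infinitesimally below one. -/

section Infinitesimal

open Polynomial

variable {M : Type*} [Field M] (V : ValuationSubring M)

/-- Elements `p / X ^ N` of `M(X)` with `p` integral over `V` and with coefficients of negative
degree in the maximal ideal. -/
def laurentSubring : Subring (RatFunc M) where
  carrier := {f | ∃ (N : ℕ) (p : M[X]), (∀ i, V.valuation (p.coeff i) ≤ 1) ∧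
    (∀ i < N, V.valuation (p.coeff i) < 1) ∧ f * RatFunc.X ^ N = algebraMap M[X] (RatFunc M) p}
  mul_mem' := by
    rintro f g ⟨N, p, hp, hp', hf⟩ ⟨N', q, hq, hq', hg⟩
    refine ⟨N + N', p * q, fun i => ?_, fun i hi => ?_, ?_⟩
    · rw [coeff_mul]
      refine Valuation.map_sum_le _ fun x _ => ?_
      rw [map_mul]
      exact mul_le_one' (hp _) (hq _)
    · rw [coeff_mul]
      refine Valuation.map_sum_lt _ one_ne_zero fun x hx => ?_
      rw [map_mul]
      rw [Finset.HasAntidiagonal.mem_antidiagonal] at hx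
      rcases lt_or_ge x.1 N with h | h
      · exact mul_lt_one_of_lt_of_le (hp' _ h) (hq _)
      · rw [mul_comm]; exact mul_lt_one_of_lt_of_le (hq' _ (by omega)) (hp _)
    · rw [map_mul, ← hf, ← hg]; ring
  one_mem' := ⟨0, 1, fun i => by rw [coeff_one]; split_ifs <;> simp, by simp, by simp⟩
  add_mem' := by
    rintro f g ⟨N, p, hp, hp', hf⟩ ⟨N', q, hq, hq', hg⟩
    refine ⟨N + N', p * X ^ N' + q * X ^ N, fun i => ?_, fun i hi => ?_, ?_⟩
    · rw [coeff_add, coeff_mul_X_pow', coeff_mul_X_pow']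
      refine Valuation.map_add_le _ ?_ ?_ <;> split_ifs <;> simp [hp, hq]
    · rw [coeff_add, coeff_mul_X_pow', coeff_mul_X_pow']
      refine Valuation.map_add_lt _ ?_ ?_ <;> split_ifs
      · exact hp' _ (by omega)
      · simp
      · exact hq' _ (by omega)
      · simp
    · simp only [map_add, map_mul, map_pow, RatFunc.algebraMap_X, ← hf, ← hg]; ring
  zero_mem' := ⟨0, 0, by simp, by simp, by simp⟩
  neg_mem' := by
    rintro f ⟨N, p, hp, hp', hf⟩
    exact ⟨N, -p, by simpa using hp, by simpa using hp', by simp [← hf]⟩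

/-- The elements of `laurentSubring V` with constant coefficient in the maximal ideal. -/
def laurentIdeal : Ideal (laurentSubring V) where
  carrier := {f | ∃ (N : ℕ) (p : M[X]), (∀ i, V.valuation (p.coeff i) ≤ 1) ∧
    (∀ i ≤ N, V.valuation (p.coeff i) < 1) ∧
      (f : RatFunc M) * RatFunc.X ^ N = algebraMap M[X] (RatFunc M) p}
  smul_mem' := by
    rintro ⟨f, N, p, hp, hp', hf⟩ ⟨g, _⟩ ⟨N', q, hq, hq', hg⟩
    refine ⟨N + N', p * q, fun i => ?_, fun i hi => ?_, ?_⟩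
    · rw [coeff_mul]
      refine Valuation.map_sum_le _ fun x _ => ?_
      rw [map_mul]
      exact mul_le_one' (hp _) (hq _)
    · rw [coeff_mul]
      refine Valuation.map_sum_lt _ one_ne_zero fun x hx => ?_
      rw [map_mul]
      rw [Finset.HasAntidiagonal.mem_antidiagonal] at hx
      rcases lt_or_ge x.1 N with h | h
      · exact mul_lt_one_of_lt_of_le (hp' _ h) (hq _)
      · rw [mul_comm]; exact mul_lt_one_of_lt_of_le (hq' _ (by omega)) (hp _)
    · simp only [map_mul, smul_eq_mul, Subring.coe_mul, ← hf] at hg ⊢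
      rw [← hg]; ring
  add_mem' := by
    rintro ⟨f, _⟩ ⟨g, _⟩ ⟨N, p, hp, hp', hf⟩ ⟨N', q, hq, hq', hg⟩
    refine ⟨N + N', p * X ^ N' + q * X ^ N, fun i => ?_, fun i hi => ?_, ?_⟩
    · rw [coeff_add, coeff_mul_X_pow', coeff_mul_X_pow']
      refine Valuation.map_add_le _ ?_ ?_ <;> split_ifs <;> simp [hp, hq]
    · rw [coeff_add, coeff_mul_X_pow', coeff_mul_X_pow']
      refine Valuation.map_add_lt _ ?_ ?_ <;> split_ifs
      · exact hp' _ (by omega)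
      · simp
      · exact hq' _ (by omega)
      · simp
    · simp only [map_add, map_mul, map_pow, RatFunc.algebraMap_X, ← hf, ← hg, Subring.coe_add]
      ring
  zero_mem' := ⟨0, 0, by simp, by simp, by simp⟩

/-- Writing `1 = p / X ^ N` forces `p = X ^ N`, whose coefficient of index `N` is not in the maximal
ideal. Properness allows a valuation ring to be chosen with this ideal among its nonunits. -/
theorem laurentIdeal_ne_top : laurentIdeal V ≠ ⊤ := by
  rw [Ne, Ideal.eq_top_iff_one]
  rintro ⟨N, p, -, hp', h⟩
  have : p = X ^ N := by
    apply IsFractionRing.injective M[X] (RatFunc M)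
    rw [← h]
    simp
  simpa [this] using hp' N le_rfl

/-- A valuation extends to `M(X)` in such a way that `X` is infinitesimally close to `1` from
below: `X` has value less than `1`, but greater than the values less than `1` on `M`. -/
theorem exists_infinitesimal_extension : ∃ W : ValuationSubring (RatFunc M),
    (∀ z : M, W.valuation (RatFunc.C z) < 1 ↔ V.valuation z < 1) ∧
    W.valuation RatFunc.X < 1 ∧
    ∀ d : M, V.valuation d < 1 → W.valuation (RatFunc.C d) < W.valuation RatFunc.X := by
  obtain ⟨W, hW, hI⟩ := Ideal.image_subset_nonunits_valuationSubring _ (laurentIdeal_ne_top V)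
  have hX0 : (RatFunc.X : RatFunc M) ≠ 0 := RatFunc.X_ne_zero
  have key : ∀ f : RatFunc M, (∃ (N : ℕ) (p : M[X]), (∀ i, V.valuation (p.coeff i) ≤ 1) ∧
    (∀ i ≤ N, V.valuation (p.coeff i) < 1) ∧
      (f : RatFunc M) * RatFunc.X ^ N = algebraMap M[X] (RatFunc M) p) → W.valuation f < 1 := by
    intro f hf
    rw [← ValuationSubring.mem_nonunits_iff]
    have hf' : f ∈ laurentSubring V := by
      obtain ⟨N, p, h1, h2, h3⟩ := hf
      exact ⟨N, p, h1, fun i hi => h2 i hi.le, h3⟩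
    exact hI ⟨⟨f, hf'⟩, hf, rfl⟩
  have hC : ∀ z : M, V.valuation z < 1 → W.valuation (RatFunc.C z) < 1 := by
    refine fun z hz => key _ ⟨0, C z, fun i => ?_, fun i _ => ?_, by simp⟩ <;>
    · rw [coeff_C]; split_ifs <;> simp [hz, hz.le]
  refine ⟨W, fun z => ⟨fun hz => ?_, hC z⟩, key _ ⟨0, X, fun i => ?_, fun i hi => ?_, by simp⟩,
    fun d hd => ?_⟩
  · by_contra hz'
    have hz0 : z ≠ 0 := by rintro rfl; simp at hz'
    have hzinv : RatFunc.C z⁻¹ ∈ W := by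
      refine hW ⟨0, C z⁻¹, fun i => ?_, by simp, by simp⟩
      rw [coeff_C]
      split_ifs
      · rw [map_inv₀]
        exact inv_le_one_of_one_le₀ (not_lt.1 hz')
      · simp
    rw [← W.valuation_le_one_iff, map_inv₀, map_inv₀,
      inv_le_one₀ (zero_lt_iff.2 ((Valuation.ne_zero_iff _).2 (by simpa using hz0)))] at hzinv
    exact absurd hz hzinv.not_gt
  · rw [coeff_X]; split_ifs <;> simp
  · rw [Nat.le_zero.1 hi]; simp
  -- The only coefficient of `d / X` is `d`, in degree `-1`, so `d / X` belongs to the ideal.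
  · have h := key (RatFunc.C d / RatFunc.X) ⟨1, C d, fun i => ?_, fun i _ => ?_, ?_⟩
    · rwa [map_div₀, div_lt_one₀ (zero_lt_iff.2 ((Valuation.ne_zero_iff _).2 hX0))] at h
    · rw [coeff_C]; split_ifs <;> simp [hd.le]
    · rw [coeff_C]; split_ifs <;> simp [hd]
    · simp [hX0]

end Infinitesimal

open Polynomial

/-- The valuation `W` of `F` extends the valuation `v` of `M`, and `u` has value less than `1`, but
greater than the values less than `1` on `M`. -/
structure IsInfinitesimalExtension {M F Γ Γ' : Type*} [Field M] [Field F] [Algebra M F]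
    [LinearOrderedCommGroupWithZero Γ] [LinearOrderedCommGroupWithZero Γ']
    (v : Valuation M Γ) (W : Valuation F Γ') (u : F) : Prop where
  lt_one_iff : ∀ z : M, W (algebraMap M F z) < 1 ↔ v z < 1
  lt_one : W u < 1
  lt : ∀ d : M, v d < 1 → W (algebraMap M F d) < W u

namespace IsInfinitesimalExtension

variable {M F Γ Γ' : Type*} [Field M] [Field F] [Algebra M F]
  [LinearOrderedCommGroupWithZero Γ] [LinearOrderedCommGroupWithZero Γ']
  {v : Valuation M Γ} {W : Valuation F Γ'} {u : F} (hu : IsInfinitesimalExtension v W u)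

include hu

theorem pos : 0 < W u := by
  simpa using hu.lt 0 (by simp)

theorem ne_zero : u ≠ 0 := (Valuation.ne_zero_iff W).1 hu.pos.ne'

theorem map_lt_iff {z z' : M} : W (algebraMap M F z) < W (algebraMap M F z') ↔ v z < v z' := by
  rcases eq_or_ne z' 0 with rfl | hz'
  · simp
  have h1 : 0 < W (algebraMap M F z') := zero_lt_iff.2 ((Valuation.ne_zero_iff _).2 (by simpa))
  have h2 : 0 < v z' := zero_lt_iff.2 ((Valuation.ne_zero_iff _).2 hz')
  have := hu.lt_one_iff (z / z')
  rwa [map_div₀, map_div₀, map_div₀, div_lt_one₀ h1, div_lt_one₀ h2] at this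

theorem map_le_iff {z z' : M} : W (algebraMap M F z) ≤ W (algebraMap M F z') ↔ v z ≤ v z' := by
  rw [← not_lt, hu.map_lt_iff, not_lt]

theorem le_one_iff {z : M} : W (algebraMap M F z) ≤ 1 ↔ v z ≤ 1 := by
  simpa using hu.map_le_iff (z' := 1)

/-- Together with `lt_mul`, this places the value of `c u` immediately below that of `c`, in a gap
of the value group of `M`. -/
theorem mul_lt {c t : M} (h : v c ≤ v t) (ht : t ≠ 0) :
    W (algebraMap M F c * u) < W (algebraMap M F t) := by
  have h1 : 0 < W (algebraMap M F t) := zero_lt_iff.2 ((Valuation.ne_zero_iff _).2 (by simpa))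
  calc W (algebraMap M F c * u) = W (algebraMap M F c) * W u := map_mul _ _ _
    _ ≤ W (algebraMap M F t) * W u := mul_le_mul_left (hu.map_le_iff.2 h) _
    _ < W (algebraMap M F t) * 1 := mul_lt_mul_of_pos_left hu.lt_one h1
    _ = _ := mul_one _

theorem lt_mul {c t : M} (h : v t < v c) :
    W (algebraMap M F t) < W (algebraMap M F c * u) := by
  have h2 : 0 < v c := zero_le.trans_lt h
  have hc : c ≠ 0 := (Valuation.ne_zero_iff v).1 h2.ne'
  have h1 : 0 < W (algebraMap M F c) := zero_lt_iff.2 ((Valuation.ne_zero_iff _).2 (by simpa))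
  have := hu.lt (t / c) (by rwa [map_div₀, div_lt_one₀ h2])
  rwa [map_div₀, map_div₀, div_lt_iff₀ h1, mul_comm, ← map_mul] at this

/-- Distinct powers of `u` are incommensurable over an algebraically closed field. -/
theorem mul_pow_ne_one [IsAlgClosed M] (e : M) {n : ℕ} (hn : n ≠ 0) :
    W (algebraMap M F e * u ^ n) ≠ 1 := by
  -- The value group of `M` is divisible: `e u ^ n = (r u) ^ n`, and `r u` has value different from
  -- `1`.
  obtain ⟨r, rfl⟩ := IsAlgClosed.exists_pow_nat_eq e (Nat.pos_of_ne_zero hn)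
  rw [map_pow, ← mul_pow, map_pow]
  rcases le_or_gt (v r) 1 with h | h
  · have := hu.mul_lt (c := r) (t := 1) (by simpa using h) one_ne_zero
    rw [map_one, map_one] at this
    exact (pow_lt_one₀ zero_le this hn).ne
  · have := hu.lt_mul (c := r) (t := 1) (by simpa using h)
    rw [map_one, map_one] at this
    exact (one_lt_pow₀ this hn).ne'

theorem mul_pow_ne [IsAlgClosed M] {e e' : M} (he : e ≠ 0) {i j : ℕ} (hij : i ≠ j) :
    W (algebraMap M F e * u ^ i) ≠ W (algebraMap M F e' * u ^ j) := by
  wlog h : i < j generalizing e e' i j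
  · rcases eq_or_ne e' 0 with rfl | he'
    · simpa using ⟨he, fun h => absurd h hu.ne_zero⟩
    · exact (this he' hij.symm (by omega)).symm
  obtain ⟨n, rfl⟩ := Nat.exists_eq_add_of_lt h
  intro heq
  refine hu.mul_pow_ne_one (e' / e) n.succ_ne_zero ?_
  have he1 : algebraMap M F e ≠ 0 := by simpa
  have h0 : W (algebraMap M F e * u ^ i) ≠ 0 :=
    (Valuation.ne_zero_iff _).2 (mul_ne_zero he1 (pow_ne_zero _ hu.ne_zero))
  have : algebraMap M F e' * u ^ (i + n + 1) =
      (algebraMap M F (e' / e) * u ^ (n + 1)) * (algebraMap M F e * u ^ i) := by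
    rw [map_div₀]
    field_simp
    ring
  rw [this, W.map_mul (_ * _)] at heq
  exact (mul_eq_right₀ h0).1 heq.symm

end IsInfinitesimalExtension

/-! ### Values of polynomials as monomials in the distance to an algebraic element. -/

section ProductForm

variable {L M F Γ Γ' : Type*} [Field L] [Field M] [Field F] [Algebra L M] [Algebra M F]
  [LinearOrderedCommGroupWithZero Γ] [LinearOrderedCommGroupWithZero Γ']
  {v : Valuation M Γ} {W : Valuation F Γ'} {u : F}

/-- The value at `x`, and at all points `a + c u` with the value of `c` in a suitable interval, of
a product of linear factors. -/
theorem exists_multiset_prod_form (hu : IsInfinitesimalExtension v W u) {a x : M}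
    (ha : IsAlgebraic L a) (s : Multiset M) (hs : ∀ b ∈ s, IsAlgebraic L b) :
    ∃ (h : M) (m : ℕ), h ≠ 0 ∧ IsAlgebraic L h ∧ (a ∈ s → m ≠ 0) ∧
      ((∀ b ∈ s, v (a - b) ≠ v (x - a)) →
        v (s.map fun b => x - b).prod = v h * v (x - a) ^ m) ∧
      ∀ t₁ t₂ : M, (∀ b ∈ s, v (x - a) < v (a - b) → v t₁ ≤ v (a - b)) →
        (∀ b ∈ s, v (a - b) ≤ v (x - a) → v (a - b) ≤ v t₂) →
        ∀ c, v t₂ < v c → v c < v t₁ →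
          W (s.map fun b => algebraMap M F a + algebraMap M F c * u - algebraMap M F b).prod =
            W (algebraMap M F h) * W (algebraMap M F c * u) ^ m := by
  induction s using Multiset.induction with
  | empty => exact ⟨1, 0, one_ne_zero, isAlgebraic_one, by simp, by simp, by simp⟩
  | cons b s ih =>
    simp only [Multiset.mem_cons, forall_eq_or_imp] at hs
    obtain ⟨h, m, hh0, hh, hm, hx, hc⟩ := ih hs.2
    -- A root farther from `a` than `x` contributes the constant factor `a - b` to `h`. Any other
    -- root contributes `x - a`, respectively `c u`, and raises `m`. The interval for `v c` makes
    -- the same alternative hold at `a + c u`.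
    rcases lt_or_ge (v (x - a)) (v (a - b)) with hab | hab
    · have hab0 : a - b ≠ 0 := (Valuation.ne_zero_iff v).1 (zero_le.trans_lt hab).ne'
      refine ⟨(a - b) * h, m, mul_ne_zero hab0 hh0, (ha.sub hs.1).mul hh, ?_, ?_, ?_⟩
      · rw [Multiset.mem_cons]
        rintro (rfl | has)
        · simp at hab0
        · exact hm has
      · intro hne
        rw [Multiset.map_cons, Multiset.prod_cons, map_mul,
          hx fun b hb => hne b (Multiset.mem_cons_of_mem hb), map_mul, mul_assoc]
        congr 1
        rw [← sub_add_sub_cancel x a b, Valuation.map_add_eq_of_lt_right _ hab]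
      · intro t₁ t₂ h1 h2 c hc2 hc1
        simp only [Multiset.mem_cons, forall_eq_or_imp] at h1 h2
        rw [Multiset.map_cons, Multiset.prod_cons, map_mul W, hc t₁ t₂ h1.2 h2.2 c hc2 hc1,
          map_mul (algebraMap M F),
          map_mul W (algebraMap M F (a - b)) (algebraMap M F h), mul_assoc]
        congr 1
        rw [add_sub_right_comm, ← map_sub, Valuation.map_add_eq_of_lt_left]
        exact hu.mul_lt (hc1.le.trans (h1.1 hab)) hab0
    · refine ⟨h, m + 1, hh0, hh, by simp, ?_, ?_⟩
      · intro hne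
        rw [Multiset.map_cons, Multiset.prod_cons, map_mul,
          hx fun b hb => hne b (Multiset.mem_cons_of_mem hb), pow_succ', mul_left_comm]
        congr 1
        rw [← sub_add_sub_cancel x a b, Valuation.map_add_eq_of_lt_left]
        exact hab.lt_of_ne (hne b (Multiset.mem_cons_self b s))
      · intro t₁ t₂ h1 h2 c hc2 hc1
        simp only [Multiset.mem_cons, forall_eq_or_imp] at h1 h2
        rw [Multiset.map_cons, Multiset.prod_cons, map_mul W, hc t₁ t₂ h1.2 h2.2 c hc2 hc1,
          pow_succ', mul_left_comm]
        congr 1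
        rw [add_sub_right_comm, ← map_sub, Valuation.map_add_eq_of_lt_right]
        exact hu.lt_mul ((h2.1 hab).trans_lt hc2)

variable [Algebra L F] [IsScalarTower L M F]

theorem exists_polynomial_prod_form [IsAlgClosed M] (hu : IsInfinitesimalExtension v W u)
    {a x : M} (ha : IsAlgebraic L a) {P : L[X]} (hP : P ≠ 0) :
    ∃ (h : M) (m : ℕ), h ≠ 0 ∧ IsAlgebraic L h ∧ (aeval a P = 0 → m ≠ 0) ∧
      ((∀ b ∈ P.aroots M, v (a - b) ≠ v (x - a)) → v (aeval x P) = v h * v (x - a) ^ m) ∧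
      ∀ t₁ t₂ : M, (∀ b ∈ P.aroots M, v (x - a) < v (a - b) → v t₁ ≤ v (a - b)) →
        (∀ b ∈ P.aroots M, v (a - b) ≤ v (x - a) → v (a - b) ≤ v t₂) →
        ∀ c, v t₂ < v c → v c < v t₁ →
          W (aeval (algebraMap M F a + algebraMap M F c * u) P) =
            W (algebraMap M F h) * W (algebraMap M F c * u) ^ m := by
  obtain ⟨h, m, hh0, hh, hm, hx, hc⟩ := exists_multiset_prod_form (L := L) hu (x := x) ha
    (P.aroots M) (fun b hb => ⟨P, hP, (mem_aroots.1 hb).2⟩)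
  have hsM : (P.map (algebraMap L M)).Splits := IsAlgClosed.splits _
  have hsF : (P.map (algebraMap L F)).Splits := by
    rw [IsScalarTower.algebraMap_eq L M F, ← Polynomial.map_map]
    exact hsM.map _
  have hroots : P.aroots F = (P.aroots M).map (algebraMap M F) := by
    rw [aroots, aroots, IsScalarTower.algebraMap_eq L M F, ← Polynomial.map_map, hsM.roots_map]
  have hlc : algebraMap L M P.leadingCoeff ≠ 0 := by simpa using hP
  refine ⟨algebraMap L M P.leadingCoeff * h, m, mul_ne_zero hlc hh0,
    (isAlgebraic_algebraMap _).mul hh, fun h0 => hm (mem_aroots.2 ⟨hP, h0⟩), fun hne => ?_,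
    fun t₁ t₂ h1 h2 c hc2 hc1 => ?_⟩
  · rw [hsM.aeval_eq_prod_aroots, map_mul, hx hne, map_mul, mul_assoc]
  · rw [hsF.aeval_eq_prod_aroots, map_mul W, hroots, Multiset.map_map]
    simp only [Function.comp_def]
    rw [hc t₁ t₂ h1 h2 c hc2 hc1, map_mul (algebraMap M F),
      map_mul W (algebraMap M F (algebraMap L M _)) (algebraMap M F h), mul_assoc,
      ← IsScalarTower.algebraMap_apply]

-- After extracting a root of `h / h'` of order `|m - m'|`, the inequality compares the value of `y`
-- with that of a single algebraic element `t`; it persists for `c u` if `v c` lies on the same side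
-- of `v t`. For `m = m'` the variable cancels, and `t = 1` is a dummy.
omit [Algebra L F] [IsScalarTower L M F] in
theorem exists_bound_of_monomial_lt [IsAlgClosed M] (hu : IsInfinitesimalExtension v W u)
    {y h h' : M} {m m' : ℕ} (hy : y ≠ 0) (hh0 : h ≠ 0) (hh0' : h' ≠ 0) (hh : IsAlgebraic L h)
    (hh' : IsAlgebraic L h') (hlt : v h * v y ^ m < v h' * v y ^ m') :
    ∃ t : M, t ≠ 0 ∧ IsAlgebraic L t ∧ ∀ c : M, c ≠ 0 →
      (v y < v t → v c < v t) → (v t ≤ v y → v t < v c) →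
        W (algebraMap M F h) * W (algebraMap M F c * u) ^ m <
          W (algebraMap M F h') * W (algebraMap M F c * u) ^ m' := by
  have hy' : 0 < v y := zero_lt_iff.2 ((Valuation.ne_zero_iff _).2 hy)
  have hvh' : 0 < v h' := zero_lt_iff.2 ((Valuation.ne_zero_iff _).2 hh0')
  have hWh' : 0 < W (algebraMap M F h') :=
    zero_lt_iff.2 ((Valuation.ne_zero_iff _).2 (by simpa using hh0'))
  have hpos : ∀ c : M, c ≠ 0 → 0 < W (algebraMap M F c * u) := fun c hc =>
    zero_lt_iff.2 ((Valuation.ne_zero_iff _).2 (mul_ne_zero (by simpa using hc) hu.ne_zero))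
  have hroot : ∀ j : ℕ, j ≠ 0 → ∃ r : M, r ≠ 0 ∧ IsAlgebraic L r ∧ h = h' * r ^ j := by
    intro j hj
    obtain ⟨r, hr⟩ := IsAlgClosed.exists_pow_nat_eq (h / h') (Nat.pos_of_ne_zero hj)
    refine ⟨r, ?_, ?_, by rw [hr]; field_simp⟩
    · rintro rfl
      rw [zero_pow hj] at hr
      exact div_ne_zero hh0 hh0' hr.symm
    · refine IsAlgebraic.of_pow (Nat.pos_of_ne_zero hj) ?_
      rw [hr, div_eq_mul_inv]
      exact hh.mul hh'.inv
  rcases lt_trichotomy m m' with hm | rfl | hm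
  · obtain ⟨j, rfl⟩ := Nat.exists_eq_add_of_lt hm
    obtain ⟨r, hr0, hr, rfl⟩ := hroot (j + 1) j.succ_ne_zero
    have h1 : v r < v y := by
      rw [map_mul, map_pow, add_assoc, pow_add _ m (j + 1), mul_comm (v y ^ m), ← mul_assoc,
        mul_lt_mul_iff_left₀ (pow_pos hy' m), mul_lt_mul_iff_right₀ hvh'] at hlt
      exact lt_of_pow_lt_pow_left₀ _ zero_le hlt
    refine ⟨r, hr0, hr, fun c hc _ h2 => ?_⟩
    have h3 := hu.lt_mul (h2 h1.le)
    rw [map_mul, map_mul W (algebraMap M F h'), map_pow, map_pow, add_assoc, pow_add _ m (j + 1),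
      mul_comm (W (algebraMap M F c * u) ^ m), ← mul_assoc,
      mul_lt_mul_iff_left₀ (pow_pos (hpos c hc) m), mul_lt_mul_iff_right₀ hWh']
    exact pow_lt_pow_left₀ h3 zero_le j.succ_ne_zero
  · refine ⟨1, one_ne_zero, isAlgebraic_one, fun c hc _ _ => ?_⟩
    rw [mul_lt_mul_iff_left₀ (pow_pos hy' m)] at hlt
    rw [mul_lt_mul_iff_left₀ (pow_pos (hpos c hc) m)]
    exact hu.map_lt_iff.2 hlt
  · obtain ⟨j, rfl⟩ := Nat.exists_eq_add_of_lt hm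
    obtain ⟨r, hr0, hr, rfl⟩ := hroot (j + 1) j.succ_ne_zero
    have hrv : 0 < v r := zero_lt_iff.2 ((Valuation.ne_zero_iff _).2 hr0)
    have h1 : v r * v y < 1 := by
      rw [map_mul, map_pow, add_assoc, pow_add _ m' (j + 1),
        mul_comm (v y ^ m'), ← mul_assoc,
        mul_lt_mul_iff_left₀ (pow_pos hy' m'), mul_assoc, ← mul_pow,
        mul_lt_iff_lt_one_right hvh'] at hlt
      exact (pow_lt_one_iff_of_nonneg zero_le j.succ_ne_zero).1 hlt
    refine ⟨r⁻¹, inv_ne_zero hr0, hr.inv, fun c hc h2 _ => ?_⟩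
    have h3 : v c < v r⁻¹ := h2 (by
      rw [map_inv₀, lt_inv_comm₀ hy' hrv, ← one_div, lt_div_iff₀ hy']
      exact h1)
    have h4 := hu.mul_lt h3.le (inv_ne_zero hr0)
    rw [map_inv₀, map_inv₀, ← one_div,
      lt_div_iff₀ (zero_lt_iff.2 ((Valuation.ne_zero_iff _).2 (by simpa using hr0))),
      mul_comm] at h4
    rw [map_mul, map_mul W (algebraMap M F h'), map_pow, map_pow, add_assoc, pow_add _ m' (j + 1),
      mul_comm (W (algebraMap M F c * u) ^ m'), ← mul_assoc,
      mul_lt_mul_iff_left₀ (pow_pos (hpos c hc) m'), mul_assoc, ← mul_pow,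
      mul_lt_iff_lt_one_right hWh']
    exact pow_lt_one₀ zero_le h4 j.succ_ne_zero

/-- A strict inequality between the values of two polynomials at `x` persists at the points
`a + c u` with the value of `c` in a suitable interval. -/
theorem exists_bound_of_lt [IsAlgClosed M] (hu : IsInfinitesimalExtension v W u)
    {a x : M} (ha : IsAlgebraic L a) (hxa : x ≠ a) {P Q : L[X]} (hP : P ≠ 0) (hQ : Q ≠ 0)
    (hneP : ∀ b ∈ P.aroots M, v (a - b) ≠ v (x - a))
    (hneQ : ∀ b ∈ Q.aroots M, v (a - b) ≠ v (x - a))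
    (hlt : v (aeval x P) < v (aeval x Q)) :
    ∃ t : M, t ≠ 0 ∧ IsAlgebraic L t ∧ ∀ t₁ t₂ : M,
      (∀ b ∈ P.aroots M + Q.aroots M, v (x - a) < v (a - b) → v t₁ ≤ v (a - b)) →
      (∀ b ∈ P.aroots M + Q.aroots M, v (a - b) ≤ v (x - a) → v (a - b) ≤ v t₂) →
      (v (x - a) < v t → v t₁ ≤ v t) → (v t ≤ v (x - a) → v t ≤ v t₂) →
      ∀ c, v t₂ < v c → v c < v t₁ →
        W (aeval (algebraMap M F a + algebraMap M F c * u) P) <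
          W (aeval (algebraMap M F a + algebraMap M F c * u) Q) := by
  obtain ⟨h, m, hh0, hh, -, hx, hc⟩ := exists_polynomial_prod_form hu (x := x) ha hP
  obtain ⟨h', m', hh0', hh', -, hx', hc'⟩ := exists_polynomial_prod_form hu (x := x) ha hQ
  rw [hx hneP, hx' hneQ] at hlt
  obtain ⟨t, ht0, ht, H⟩ :=
    exists_bound_of_monomial_lt hu (sub_ne_zero.2 hxa) hh0 hh0' hh hh' hlt
  refine ⟨t, ht0, ht, fun t₁ t₂ h1 h2 h3 h4 c hc2 hc1 => ?_⟩
  rw [hc t₁ t₂ (fun b hb => h1 b (Multiset.mem_add.2 (.inl hb)))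
      (fun b hb => h2 b (Multiset.mem_add.2 (.inl hb))) c hc2 hc1,
    hc' t₁ t₂ (fun b hb => h1 b (Multiset.mem_add.2 (.inr hb)))
      (fun b hb => h2 b (Multiset.mem_add.2 (.inr hb))) c hc2 hc1]
  have hc0 : c ≠ 0 := (Valuation.ne_zero_iff v).1 (zero_le.trans_lt hc2).ne'
  exact H c hc0 (fun h => hc1.trans_le (h3 h)) (fun h => (h4 h).trans_lt hc2)

end ProductForm

/-! ### Algebraic approximations that preserve the residue field. -/

open Polynomial IntermediateField

namespace Valuation

theorem map_sum_sub_lt {ι R Γ : Type*} [Ring R] [LinearOrderedCommGroupWithZero Γ]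
    (v : Valuation R Γ) {s : Finset ι} {g : ι → R} {i : ι} (hi : i ∈ s) (h0 : v (g i) ≠ 0)
    (h : ∀ j ∈ s, j ≠ i → v (g j) < v (g i)) : v (∑ j ∈ s, g j - g i) < v (g i) := by
  classical
  rw [← Finset.add_sum_erase s g hi, add_sub_cancel_left]
  exact v.map_sum_lt h0 fun j hj => h j (Finset.mem_of_mem_erase hj) (Finset.ne_of_mem_erase hj)

variable {L M Γ : Type*} [Field L] [Field M] [Algebra L M] [LinearOrderedCommGroupWithZero Γ]
  (v : Valuation M Γ)

/-- The value group of an algebraic extension is torsion over the value group of the base. -/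
theorem exists_pow_eq_of_isAlgebraic {e : M} (he : IsAlgebraic L e) (he0 : e ≠ 0) :
    ∃ (n : ℕ) (r : L), n ≠ 0 ∧ r ≠ 0 ∧ v (e ^ n) = v (algebraMap L M r) := by
  obtain ⟨p, hp, hpe⟩ := he
  obtain ⟨i, hi, hmax⟩ := p.support.exists_max_image
    (fun i => v (algebraMap L M (p.coeff i) * e ^ i))
    (nonempty_support_iff.2 hp)
  have hne : ∀ j ∈ p.support, algebraMap L M (p.coeff j) * e ^ j ≠ 0 := fun j hj =>
    mul_ne_zero (by simpa using hj) (pow_ne_zero _ he0)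
  have hsum : ∑ j ∈ p.support, algebraMap L M (p.coeff j) * e ^ j = 0 := by
    rw [← hpe, aeval_def, eval₂_eq_sum, Polynomial.sum]
  -- The terms add up to zero, so the largest value is attained at least twice.
  obtain ⟨j, hj, hji, heq⟩ : ∃ j ∈ p.support, j ≠ i ∧
      v (algebraMap L M (p.coeff j) * e ^ j) = v (algebraMap L M (p.coeff i) * e ^ i) := by
    by_contra! hcon
    have := v.map_sum_sub_lt hi ((ne_zero_iff v).2 (hne i hi)) fun j hj hji =>
      (hmax j hj).lt_of_ne (hcon j hj hji)
    rw [hsum, zero_sub, map_neg] at this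
    exact this.false
  have key : ∀ i j : ℕ, i ∈ p.support → j ∈ p.support → i < j →
      v (algebraMap L M (p.coeff j) * e ^ j) = v (algebraMap L M (p.coeff i) * e ^ i) →
      ∃ (n : ℕ) (r : L), n ≠ 0 ∧ r ≠ 0 ∧ v (e ^ n) = v (algebraMap L M r) := by
    intro i j hi hj hij h
    rw [mem_support_iff] at hi hj
    obtain ⟨n, rfl⟩ := Nat.exists_eq_add_of_lt hij
    refine ⟨n + 1, p.coeff i / p.coeff (i + n + 1), n.succ_ne_zero, div_ne_zero hi hj, ?_⟩
    have h0 : v (algebraMap L M (p.coeff (i + n + 1))) ≠ 0 :=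
      (ne_zero_iff v).2 (by simpa using hj)
    have h1 : v (e ^ i) ≠ 0 := (ne_zero_iff v).2 (pow_ne_zero _ he0)
    rw [map_div₀, map_div₀, eq_div_iff h0, mul_comm, ← mul_left_inj' h1, ← map_mul, ← map_mul,
      ← map_mul, mul_assoc, ← pow_add, ← h, add_assoc, add_comm (n + 1) i]
  rcases lt_or_gt_of_ne hji with h | h
  · exact key j i hj hi h heq.symm
  · exact key i j hi hj h heq

/-- Each quotient `(x - b) / (a - b)` is congruent to `1` modulo the maximal ideal, hence so is
their product. -/
theorem map_multiset_prod_sub_lt {a x : M} (s : Multiset M) (hs : ∀ b ∈ s, v (x - a) < v (x - b)) :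
    v ((s.map fun b => x - b).prod - (s.map fun b => a - b).prod) <
      v (s.map fun b => a - b).prod := by
  induction s using Multiset.induction with
  | empty => simp
  | cons b s ih =>
    simp only [Multiset.mem_cons, forall_eq_or_imp] at hs
    have ih := ih hs.2
    simp only [Multiset.map_cons, Multiset.prod_cons]
    have h1 : v (a - b) = v (x - b) := by
      have e : a - b = (x - b) - (x - a) := by ring
      rw [e, Valuation.map_sub_eq_of_lt_left _ hs.1]
    set X := (s.map fun b => x - b).prod
    set A := (s.map fun b => a - b).prod
    have hA : 0 < v A := zero_le.trans_lt ih
    have hab : 0 < v (a - b) := by rw [h1]; exact zero_le.trans_lt hs.1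
    have e : (x - b) * X - (a - b) * A = (x - b) * (X - A) + (x - a) * A := by ring
    rw [e, map_mul v (a - b)]
    refine Valuation.map_add_lt _ ?_ ?_
    · rw [map_mul, ← h1]
      exact mul_lt_mul_of_pos_left ih hab
    · rw [map_mul, h1]
      exact mul_lt_mul_of_pos_right hs.1 hA

/-- If no element of smaller degree approximates `x` as well as `a` does, then polynomials of
smaller degree take equivalent values at `x` and at `a`. -/
theorem map_aeval_sub_lt [IsAlgClosed M] {a x : M}
    (hmin : ∀ b : M, IsAlgebraic L b → (minpoly L b).natDegree < (minpoly L a).natDegree →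
      v (x - a) < v (x - b)) {p : L[X]} (hp : p ≠ 0)
    (hdeg : p.natDegree < (minpoly L a).natDegree) :
    v (aeval x p - aeval a p) < v (aeval a p) := by
  have hs : (p.map (algebraMap L M)).Splits := IsAlgClosed.splits _
  have hlc : 0 < v (algebraMap L M p.leadingCoeff) :=
    zero_lt_iff.2 ((ne_zero_iff v).2 (by simpa using hp))
  rw [hs.aeval_eq_prod_aroots, hs.aeval_eq_prod_aroots, ← mul_sub, map_mul, map_mul]
  -- A root of `p` has degree at most that of `p`, hence less than that of `a`, so it is farther
  -- from `x` than `a` is.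
  refine mul_lt_mul_of_pos_left (v.map_multiset_prod_sub_lt _ fun b hb => ?_) hlc
  have hb' := (mem_aroots.1 hb).2
  exact hmin b ⟨p, hp, hb'⟩ ((natDegree_le_of_dvd (minpoly.dvd L b hb') hp).trans_lt hdeg)

variable {k : Type*} [Field k] [Algebra k L] [Algebra k M] [IsScalarTower k L M]

omit [Algebra k L] [IsScalarTower k L M] in
/-- In the situation of `map_aeval_sub_lt`, if every integral element of `L(x)` is congruent to a
constant, then so is every integral element of `L(a)`. -/
theorem exists_sub_lt_of_mem_adjoin [IsAlgClosed M] {a x : M} (ha : IsAlgebraic L a)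
    (hmin : ∀ b : M, IsAlgebraic L b → (minpoly L b).natDegree < (minpoly L a).natDegree →
      v (x - a) < v (x - b))
    (hres : ∀ f ∈ L⟮x⟯, v f ≤ 1 → ∃ c : k, v (f - algebraMap k M c) < 1) :
    ∀ z ∈ L⟮a⟯, v z ≤ 1 → ∃ c : k, v (z - algebraMap k M c) < 1 := by
  intro z hz hz1
  obtain ⟨q, rfl⟩ : ∃ q : L[X], aeval a q = z := by
    rw [← IntermediateField.mem_toSubalgebra, adjoin_simple_toSubalgebra_of_isAlgebraic ha,
      Algebra.adjoin_singleton_eq_range_aeval] at hz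
    exact hz
  -- Reduction modulo the minimal polynomial of `a` gives a representative of smaller degree, whose
  -- values at `x` and at `a` are equivalent.
  have hmonic := minpoly.monic ha.isIntegral
  have hq : aeval a (q %ₘ minpoly L a) = aeval a q := 
    aeval_modByMonic_eq_self_of_root (minpoly.aeval L a)
  rw [← hq] at hz1 ⊢
  rcases eq_or_ne (q %ₘ minpoly L a) 0 with h0 | h0
  · exact ⟨0, by simp [h0]⟩
  have hlt := v.map_aeval_sub_lt hmin h0 (natDegree_modByMonic_lt q hmonic (minpoly.ne_one L a))
  set p := q %ₘ minpoly L a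
  have hx1 : v (aeval x p) ≤ 1 := by
    rw [← sub_add_cancel (aeval x p) (aeval a p), Valuation.map_add_eq_of_lt_right _ hlt]
    exact hz1
  obtain ⟨c, hc⟩ := hres _ (algebra_adjoin_le_adjoin L {x} (aeval_mem_adjoin_singleton L x)) hx1
  refine ⟨c, ?_⟩
  have e : aeval a p - algebraMap k M c =
      (aeval x p - algebraMap k M c) - (aeval x p - aeval a p) := by ring
  rw [e]
  exact v.map_sub_lt hc (hlt.trans_le hz1)

/-- If `v (x - a) = v t`, then `z = (x - a) / t` is a unit whose residue is algebraic over `k`, as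
`M` is algebraic over `L(x)`, whose residue field is `k`. Hence `z` is congruent to some `ρ`
algebraic over `k`, and `a + t ρ` is closer to `x` than `a`, against minimality. -/
theorem ne_map_of_forall_le [IsAlgClosed M] {a x t : M}
    (hk : ∀ c : k, c ≠ 0 → v (algebraMap k M c) = 1)
    (hres : ∀ f ∈ L⟮x⟯, v f ≤ 1 → ∃ c : k, v (f - algebraMap k M c) < 1)
    (halg : Algebra.IsAlgebraic L⟮x⟯ M) (ha : IsAlgebraic L a) (ht : IsAlgebraic L t) (ht0 : t ≠ 0)
    (hmin : ∀ b : M, IsAlgebraic L b → v (x - a) ≤ v (x - b)) : v (x - a) ≠ v t := by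
  intro heq
  have hvt : v t ≠ 0 := (ne_zero_iff v).2 ht0
  set z := (x - a) / t with hz
  have hz1 : v z = 1 := by rw [map_div₀, heq, div_self hvt]
  obtain ⟨q, hq0, hqz⟩ := halg.isAlgebraic z
  obtain ⟨j, hj, hmax⟩ := q.support.exists_max_image (fun i => v (q.coeff i : M))
    (nonempty_support_iff.2 hq0)
  have hj0 : (q.coeff j : M) ≠ 0 := by simpa using hj
  have hvj : 0 < v (q.coeff j : M) := zero_lt_iff.2 ((ne_zero_iff v).2 hj0)
  have hc : ∀ i, ∃ c : k, i ∈ q.support →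
      v ((q.coeff i / q.coeff j : L⟮x⟯) - algebraMap k M c) < 1 := by
    intro i
    by_cases hi : i ∈ q.support
    · obtain ⟨c, hc⟩ := hres _ (q.coeff i / q.coeff j).2 (by
        push_cast
        rw [map_div₀]
        exact div_le_one_of_le₀ (hmax i hi) zero_le)
      exact ⟨c, fun _ => hc⟩
    · exact ⟨0, fun h => absurd h hi⟩
  choose c hc using hc
  have hcj : c j ≠ 0 := by
    intro h0
    have := hc j hj
    rw [h0, map_zero, sub_zero] at this
    push_cast at this
    rw [div_self hj0, map_one] at this
    exact this.false
  -- This is the residue of the equation `q` of `z`, normalized by its coefficient of largest value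
  -- so that it is nonzero.
  let p : k[X] := ∑ i ∈ q.support, monomial i (c i)
  have hp0 : p ≠ 0 := by
    intro h0
    have : p.coeff j = c j := by
      simp only [p, finsetSum_coeff, coeff_monomial]
      rw [Finset.sum_ite_eq' , if_pos hj]
    rw [h0, coeff_zero] at this
    exact hcj this.symm
  have hpz : v (aeval z p) < 1 := by
    have h1 : ∑ i ∈ q.support, ((q.coeff i / q.coeff j : L⟮x⟯) : M) * z ^ i = 0 := by
      have : ∑ i ∈ q.support, (q.coeff i : M) * z ^ i = 0 := by
        rw [← hqz, aeval_def, eval₂_eq_sum, Polynomial.sum]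
        rfl
      push_cast
      simp only [div_mul_eq_mul_div]
      rw [← Finset.sum_div, this, zero_div]
    have h2 : aeval z p = - ∑ i ∈ q.support,
        (((q.coeff i / q.coeff j : L⟮x⟯) : M) - algebraMap k M (c i)) * z ^ i := by
      simp only [sub_mul, Finset.sum_sub_distrib, h1, p, map_sum, aeval_monomial]
      simp
    rw [h2, map_neg]
    refine v.map_sum_lt one_ne_zero fun i hi => ?_
    rw [map_mul, map_pow, hz1, one_pow, mul_one]
    exact hc i hi
  have hs : (p.map (algebraMap k M)).Splits := IsAlgClosed.splits _
  rw [hs.aeval_eq_prod_aroots, map_mul, hk _ (leadingCoeff_ne_zero.2 hp0), one_mul] at hpz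
  obtain ⟨ρ, hρ, hρz⟩ : ∃ ρ ∈ p.aroots M, v (z - ρ) < 1 := by
    by_contra! hcon
    refine hpz.not_ge ?_
    rw [map_multiset_prod, Multiset.map_map]
    refine Multiset.one_le_prod fun y hy => ?_
    obtain ⟨ρ, hρ, rfl⟩ := Multiset.mem_map.1 hy
    exact hcon ρ hρ
  have hρalg : IsAlgebraic L ρ := IsAlgebraic.tower_top L ⟨p, hp0, (mem_aroots.1 hρ).2⟩
  have h3 := hmin (a + t * ρ) (ha.add (ht.mul hρalg))
  have h4 : x - (a + t * ρ) = t * (z - ρ) := by rw [hz]; field_simp; ring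
  rw [h4, map_mul, heq] at h3
  exact h3.not_gt (mul_lt_of_lt_one_right (zero_lt_iff.2 hvt) hρz)

/-- Choice of an algebraic element close to `x`, generating an extension with the same residue
field, relative to finitely many given algebraic elements. -/
theorem exists_isAlgebraic_approximation [IsAlgClosed M] {x : M}
    (hk : ∀ c : k, c ≠ 0 → v (algebraMap k M c) = 1)
    (hres : ∀ f ∈ L⟮x⟯, v f ≤ 1 → ∃ c : k, v (f - algebraMap k M c) < 1)
    (halg : Algebra.IsAlgebraic L⟮x⟯ M) (hx : Transcendental L x)
    (S : Finset M) (hS : ∀ b ∈ S, IsAlgebraic L b) :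
    ∃ a : M, IsAlgebraic L a ∧ (∀ b ∈ S, v (a - b) ≠ v (x - a)) ∧
      ∀ z ∈ L⟮a⟯, v z ≤ 1 → ∃ c : k, v (z - algebraMap k M c) < 1 := by
  have hwf := (InvImage.wf (fun b : M => (minpoly L b).natDegree) Nat.lt_wfRel.wf)
  by_cases hcase : ∃ b : M, IsAlgebraic L b ∧ ∀ s ∈ S, v (x - b) < v (x - s)
  -- Among the algebraic elements closer to `x` than all of `S`, one of least degree is taken; an
  -- element of smaller degree at least as close would qualify too.
  · obtain ⟨a, ⟨ha, haS⟩, hamin⟩ := hwf.has_min _ hcase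
    refine ⟨a, ha, fun b hb => ?_, v.exists_sub_lt_of_mem_adjoin ha (fun b hb hdeg => ?_) hres⟩
    · have : a - b = (x - b) - (x - a) := by ring
      rw [this, Valuation.map_sub_eq_of_lt_left _ (haS b hb)]
      exact (haS b hb).ne'
    · by_contra! hle
      exact hamin b ⟨hb, fun s hs => hle.trans_lt (haS s hs)⟩ hdeg
  -- No algebraic element beats `S`, so the least distance from `x` to `S` is the least over all
  -- algebraic elements; `a` has least degree among those attaining it.
  · push Not at hcase
    obtain ⟨s₀, hs₀, hmin₀⟩ := S.exists_min_image (fun s => v (x - s)) (by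
      obtain ⟨s, hs, -⟩ := hcase 0 isAlgebraic_zero
      exact ⟨s, hs⟩)
    have hle : ∀ b : M, IsAlgebraic L b → v (x - s₀) ≤ v (x - b) := fun b hb => by
      obtain ⟨s, hs, h⟩ := hcase b hb
      exact (hmin₀ s hs).trans h
    obtain ⟨a, ⟨ha, haS⟩, hamin⟩ := hwf.has_min {b : M | IsAlgebraic L b ∧ v (x - b) ≤ v (x - s₀)}
      ⟨s₀, hS s₀ hs₀, le_rfl⟩
    refine ⟨a, ha, fun b hb => ?_, v.exists_sub_lt_of_mem_adjoin ha (fun b hb hdeg => ?_) hres⟩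
    · rcases eq_or_ne a b with rfl | hab
      · rw [sub_self, map_zero]
        refine ((ne_zero_iff v).2 (sub_ne_zero.2 ?_)).symm
        rintro rfl
        exact hx ha
      · exact (v.ne_map_of_forall_le hk hres halg ha (ha.sub (hS b hb)) (sub_ne_zero.2 hab)
          fun b hb => haS.trans (hle b hb)).symm
    · by_contra! hle
      exact hamin b ⟨hb, hle.trans haS⟩ hdeg

omit [Algebra k L] [Algebra k M] [IsScalarTower k L M]

/-- Two elements bounding an interval of values around `δ` which avoids the values of a finite set,
except possibly at its ends. -/
theorem exists_interval (δ : Γ) (T : Finset M) (hT : ∀ t ∈ T, t ≠ 0 ∧ IsAlgebraic L t)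
    {d : M} (hd0 : d ≠ 0) (hd : IsAlgebraic L d) (hd1 : v d < 1) :
    ∃ t₁ t₂ : M, t₁ ≠ 0 ∧ t₂ ≠ 0 ∧ IsAlgebraic L t₁ ∧ IsAlgebraic L t₂ ∧ v t₂ < v t₁ ∧
      (∀ t ∈ T, δ < v t → v t₁ ≤ v t) ∧ ∀ t ∈ T, v t ≤ δ → v t ≤ v t₂ := by
  classical
  have hdpos : 0 < v d := zero_lt_iff.2 ((ne_zero_iff v).2 hd0)
  rcases (T.filter fun t => δ < v t).eq_empty_or_nonempty with h1 | h1 <;>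
  rcases (T.filter fun t => v t ≤ δ).eq_empty_or_nonempty with h2 | h2
  · simp only [Finset.filter_eq_empty_iff] at h1 h2
    -- Without constraints any interval will do; `d` supplies one, and below it supplies a missing
    -- endpoint.
    exact ⟨1, d, one_ne_zero, hd0, isAlgebraic_one, hd, by simpa using hd1,
      fun t ht h => absurd h (h1 ht), fun t ht h => absurd h (h2 ht)⟩
  · simp only [Finset.filter_eq_empty_iff] at h1
    obtain ⟨t₂, ht₂, hmax⟩ := Finset.exists_max_image _ v h2
    simp only [Finset.mem_filter] at ht₂ hmax
    have ht0 := hT _ ht₂.1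
    refine ⟨t₂ / d, t₂, div_ne_zero ht0.1 hd0, ht0.1, ?_, ht0.2, ?_,
      fun t ht h => absurd h (h1 ht), fun t ht h => hmax t ⟨ht, h⟩⟩
    · rw [div_eq_mul_inv]; exact ht0.2.mul hd.inv
    · rw [map_div₀, lt_div_iff₀ hdpos]
      exact mul_lt_of_lt_one_right (zero_lt_iff.2 ((ne_zero_iff v).2 ht0.1)) hd1
  · simp only [Finset.filter_eq_empty_iff] at h2
    obtain ⟨t₁, ht₁, hmin⟩ := Finset.exists_min_image _ v h1
    simp only [Finset.mem_filter] at ht₁ hmin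
    have ht0 := hT _ ht₁.1
    refine ⟨t₁, t₁ * d, ht0.1, mul_ne_zero ht0.1 hd0, ht0.2, ht0.2.mul hd, ?_,
      fun t ht h => hmin t ⟨ht, h⟩, fun t ht h => absurd h (h2 ht)⟩
    rw [map_mul]
    exact mul_lt_of_lt_one_right (zero_lt_iff.2 ((ne_zero_iff v).2 ht0.1)) hd1
  · obtain ⟨t₂, ht₂, hmax⟩ := Finset.exists_max_image _ v h2
    obtain ⟨t₁, ht₁, hmin⟩ := Finset.exists_min_image _ v h1
    simp only [Finset.mem_filter] at ht₁ hmin ht₂ hmax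
    exact ⟨t₁, t₂, (hT _ ht₁.1).1, (hT _ ht₂.1).1, (hT _ ht₁.1).2, (hT _ ht₂.1).2,
      ht₂.2.trans_lt ht₁.2, fun t ht h => hmin t ⟨ht, h⟩, fun t ht h => hmax t ⟨ht, h⟩⟩

/-- The geometric mean `t₂ r`, with `r ^ 2 = t₁ / t₂`, lies strictly between. -/
theorem exists_between [IsAlgClosed M] {t₁ t₂ : M} (ht₂ : t₂ ≠ 0)
    (h1 : IsAlgebraic L t₁) (h2 : IsAlgebraic L t₂) (hlt : v t₂ < v t₁) :
    ∃ e : M, IsAlgebraic L e ∧ v t₂ < v e ∧ v e < v t₁ := by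
  obtain ⟨r, hr⟩ := IsAlgClosed.exists_pow_nat_eq (t₁ / t₂) two_pos
  have hpos : 0 < v t₂ := zero_lt_iff.2 ((ne_zero_iff v).2 ht₂)
  have hr1 : 1 < v r := by
    have : 1 < v r ^ 2 := by rwa [← map_pow, hr, map_div₀, one_lt_div₀ hpos]
    exact (one_lt_pow_iff_of_nonneg zero_le two_ne_zero).1 this
  have ht₁ : t₁ = t₂ * r * r := by rw [mul_assoc, ← pow_two, hr]; field_simp
  refine ⟨t₂ * r, h2.mul (IsAlgebraic.of_pow two_pos ?_), ?_, ?_⟩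
  · rw [hr, div_eq_mul_inv]; exact h1.mul h2.inv
  · rw [map_mul]
    exact lt_mul_of_one_lt_right hpos hr1
  · rw [ht₁, map_mul v (t₂ * r)]
    refine lt_mul_of_one_lt_right ?_ hr1
    rw [map_mul]
    exact mul_pos hpos (zero_lt_one.trans hr1)

end Valuation

/-! ### Perturbing `x` to `a + c u`. -/

section InfinitesimalPerturbation

variable {k L M F Γ Γ' : Type*} [Field k] [Field L] [Field M] [Field F] [Algebra L M] [Algebra M F]
  [Algebra L F] [IsScalarTower L M F]
  [LinearOrderedCommGroupWithZero Γ] [LinearOrderedCommGroupWithZero Γ']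
  {v : Valuation M Γ} {W : Valuation F Γ'} {u : F}

/-- The dominant term of a polynomial at `a + c u`. -/
theorem exists_dominant_term [IsAlgClosed M] (hu : IsInfinitesimalExtension v W u) (a : M) {c : M}
    (hc : c ≠ 0) {P : L[X]} (hP : P ≠ 0) :
    ∃ (i : ℕ) (r : M), r ∈ L⟮a⟯ ∧ r ≠ 0 ∧
      W (aeval (algebraMap M F a + algebraMap M F c * u) P - algebraMap M F (r * c ^ i) * u ^ i) <
        W (algebraMap M F (r * c ^ i) * u ^ i) := by
  -- The Taylor expansion at `a` has coefficients in `L(a)`; at `c u` its nonzero terms have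
  -- pairwise distinct values, so one of them dominates.
  set R₀ : L⟮a⟯[X] := taylor (AdjoinSimple.gen L a) (P.map (algebraMap L L⟮a⟯)) with hR₀
  have hR₀0 : R₀ ≠ 0 := by
    rw [Ne, hR₀, map_eq_zero_iff _ (taylor_injective _), Polynomial.map_eq_zero]
    exact hP
  have hval : aeval (algebraMap M F a + algebraMap M F c * u) P =
      ∑ i ∈ R₀.support, algebraMap M F ((R₀.coeff i : M) * c ^ i) * u ^ i := by
    have h1 : aeval (algebraMap M F c * u) (R₀.map (algebraMap L⟮a⟯ M)) =
        aeval (algebraMap M F a + algebraMap M F c * u) P := by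
      rw [hR₀, taylor_apply, Polynomial.map_comp, Polynomial.map_map, aeval_comp,
        ← IsScalarTower.algebraMap_eq L L⟮a⟯ M, aeval_map_algebraMap]
      congr 1
      simp [add_comm]
    rw [← h1, aeval_def, eval₂_map, eval₂_eq_sum, Polynomial.sum]
    refine Finset.sum_congr rfl fun i _ => ?_
    rw [map_mul, map_pow, mul_pow, mul_assoc]
    rfl
  have hne : ∀ i ∈ R₀.support, (R₀.coeff i : M) * c ^ i ≠ 0 := fun i hi =>
    mul_ne_zero (by simpa using hi) (pow_ne_zero _ hc)
  obtain ⟨i, hi, hmax⟩ := R₀.support.exists_max_image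
    (fun i => W (algebraMap M F ((R₀.coeff i : M) * c ^ i) * u ^ i)) (nonempty_support_iff.2 hR₀0)
  refine ⟨i, R₀.coeff i, (R₀.coeff i).2, by simpa using hi, ?_⟩
  rw [hval]
  refine W.map_sum_sub_lt hi ?_ fun j hj hji =>
    (hmax j hj).lt_of_ne (hu.mul_pow_ne (hne j hj) hji)
  exact (Valuation.ne_zero_iff W).2 (mul_ne_zero (by simpa using hne i hi)
    (pow_ne_zero _ hu.ne_zero))

theorem transcendental_add_mul [IsAlgClosed M] (hu : IsInfinitesimalExtension v W u) (a : M) {c : M}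
    (hc : c ≠ 0) : Transcendental L (algebraMap M F a + algebraMap M F c * u) := by
  rintro ⟨P, hP, h0⟩
  obtain ⟨i, r, -, -, h⟩ := exists_dominant_term hu a hc hP
  rw [h0, zero_sub, Valuation.map_neg] at h
  exact h.false

theorem Valuation.map_div_sub_div_lt_one {A B A' B' : F} (hA : W (A - A') < W A')
    (hB : W (B - B') < W B') (h : W A' ≤ W B') : W (A / B - A' / B') < 1 := by
  have hBB : W B = W B' := by
    rw [← sub_add_cancel B B', Valuation.map_add_eq_of_lt_right _ hB]
  have hB'0 : 0 < W B' := zero_le.trans_lt hB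
  have hA'0 : 0 < W A' := zero_le.trans_lt hA
  have hb' : B' ≠ 0 := (Valuation.ne_zero_iff W).1 hB'0.ne'
  have hb : B ≠ 0 := (Valuation.ne_zero_iff W).1 (by rw [hBB]; exact hB'0.ne')
  have e : A / B - A' / B' = ((A - A') * B' - (B - B') * A') / (B * B') := by
    field_simp
    ring
  rw [e, map_div₀, map_mul W B, hBB, div_lt_one₀ (mul_pos hB'0 hB'0)]
  refine Valuation.map_sub_lt _ ?_ ?_
  · rw [map_mul]
    exact mul_lt_mul_of_pos_right (hA.trans_le h) hB'0
  · rw [map_mul]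
    exact (mul_lt_mul_of_pos_right hB hA'0).trans_le (mul_le_mul_right h _)

variable [Algebra k M] [Algebra k F] [IsScalarTower k M F]

/-- If all integral elements of `L(a)` are congruent to constants, then so are those of
`L(a + c u)`. -/
theorem exists_sub_lt_of_mem_adjoin_add_mul [IsAlgClosed M] (hu : IsInfinitesimalExtension v W u)
    {a c : M} (hc : c ≠ 0)
    (hres : ∀ z ∈ L⟮a⟯, v z ≤ 1 → ∃ c : k, v (z - algebraMap k M c) < 1) :
    ∀ f ∈ L⟮algebraMap M F a + algebraMap M F c * u⟯, W f ≤ 1 →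
      ∃ c : k, W (f - algebraMap k F c) < 1 := by
  intro f hf hf1
  obtain ⟨P, Q, rfl⟩ := (mem_adjoin_simple_iff L f).1 hf
  set y := algebraMap M F a + algebraMap M F c * u
  rcases lt_or_eq_of_le hf1 with hlt | heq
  · exact ⟨0, by simpa using hlt⟩
  have hP : P ≠ 0 := by rintro rfl; simp at heq
  have hQ : Q ≠ 0 := by rintro rfl; simp at heq
  obtain ⟨i, r, hr, hr0, hi⟩ := exists_dominant_term hu a hc hP
  obtain ⟨j, s, hs, hs0, hj⟩ := exists_dominant_term hu a hc hQ
  have hWP : W (aeval y P) = W (algebraMap M F (r * c ^ i) * u ^ i) := by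
    rw [← sub_add_cancel (aeval y P) (algebraMap M F (r * c ^ i) * u ^ i),
      Valuation.map_add_eq_of_lt_right _ hi]
  have hWQ : W (aeval y Q) = W (algebraMap M F (s * c ^ j) * u ^ j) := by
    rw [← sub_add_cancel (aeval y Q) (algebraMap M F (s * c ^ j) * u ^ j),
      Valuation.map_add_eq_of_lt_right _ hj]
  have hWeq : W (algebraMap M F (r * c ^ i) * u ^ i) = W (algebraMap M F (s * c ^ j) * u ^ j) := by
    rw [← hWP, ← hWQ]
    rw [map_div₀, div_eq_one_iff_eq] at heq
    · exact heq
    · rw [hWQ]; exact (zero_le.trans_lt hj).ne'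
  -- Equal values force equal exponents of `u`, so the dominant terms have a quotient in `L(a)`,
  -- where residues are constants by hypothesis.
  obtain rfl : i = j := by
    by_contra hij
    exact hu.mul_pow_ne (mul_ne_zero hr0 (pow_ne_zero _ hc)) hij hWeq
  have hdiv := Valuation.map_div_sub_div_lt_one hi hj hWeq.le
  have hq : algebraMap M F (r * c ^ i) * u ^ i / (algebraMap M F (s * c ^ i) * u ^ i) =
      algebraMap M F (r / s) := by
    have h1 : algebraMap M F s ≠ 0 := by simpa
    have h2 : algebraMap M F c ≠ 0 := by simpa
    have h3 := hu.ne_zero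
    simp only [map_mul, map_div₀, map_pow]
    field_simp
  rw [hq] at hdiv
  have hrs : v (r / s) ≤ 1 := by
    rw [← hu.le_one_iff, ← hq, map_div₀, hWeq]
    exact div_self_le_one _
  obtain ⟨c', hc'⟩ := hres _ (div_mem hr hs) hrs
  refine ⟨c', ?_⟩
  have e : aeval y P / aeval y Q - algebraMap k F c' = (aeval y P / aeval y Q -
      algebraMap M F (r / s)) + algebraMap M F (r / s - algebraMap k M c') := by
    rw [map_sub, ← IsScalarTower.algebraMap_apply k M F]
    ring
  rw [e]
  exact W.map_add_lt hdiv ((hu.lt_one_iff _).2 hc')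

/-- Points `a + c u` with sufficiently different values of `c` are separated by a polynomial. -/
theorem exists_separating_polynomial [IsAlgClosed M] (hu : IsInfinitesimalExtension v W u)
    {a x t₁ t₂ c₁ c₂ e : M} (ha : IsAlgebraic L a) (he : IsAlgebraic L e)
    (h1 : ∀ b ∈ (minpoly L a).aroots M, v (x - a) < v (a - b) → v t₁ ≤ v (a - b))
    (h2 : ∀ b ∈ (minpoly L a).aroots M, v (a - b) ≤ v (x - a) → v (a - b) ≤ v t₂)
    (ht₂ : v t₂ < v c₂) (hc₂ : v c₂ < v e) (hc₁ : v e < v c₁) (ht₁ : v c₁ < v t₁) :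
    ∃ P : L[X], W (aeval (algebraMap M F a + algebraMap M F c₂ * u) P) < 1 ∧
      1 < W (aeval (algebraMap M F a + algebraMap M F c₁ * u) P) := by
  obtain ⟨h, m, hh0, hh, hm, -, hval⟩ :=
    exists_polynomial_prod_form hu (x := x) ha (minpoly.ne_zero ha.isIntegral)
  have hm := hm (minpoly.aeval L a)
  have hval := hval t₁ t₂ h1 h2
  have he0 : e ≠ 0 := (Valuation.ne_zero_iff v).1 (zero_le.trans_lt hc₂).ne'
  obtain ⟨n, r, hn, hr0, hr⟩ := v.exists_pow_eq_of_isAlgebraic (hh.mul (he.pow m))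
    (mul_ne_zero hh0 (pow_ne_zero _ he0))
  have hr' : W (algebraMap L F r) = (W (algebraMap M F h) * W (algebraMap M F e) ^ m) ^ n := by
    rw [← map_pow W, ← map_mul W, ← map_pow W, ← map_pow, ← map_mul, ← map_pow,
      IsScalarTower.algebraMap_apply L M F]
    exact le_antisymm (hu.map_le_iff.2 hr.ge) (hu.map_le_iff.2 hr.le)
  have hrpos : 0 < W (algebraMap L F r) := zero_lt_iff.2 ((Valuation.ne_zero_iff W).2 (by simpa))
  have hhpos : 0 < W (algebraMap M F h) := zero_lt_iff.2 ((Valuation.ne_zero_iff W).2 (by simpa))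
  -- The minimal polynomial takes the value of `h (c u) ^ m` at `a + c u`, and `r` has the value of
  -- `(h e ^ m) ^ n`. So this polynomial compares `c u` with `e`, and the exponents `m` and `n` are
  -- nonzero.
  refine ⟨C r⁻¹ * minpoly L a ^ n, ?_, ?_⟩
  · rw [map_mul, aeval_C, map_inv₀, map_mul W, map_inv₀, map_pow, map_pow,
      inv_mul_lt_iff₀ hrpos, mul_one, hr', hval c₂ ht₂ (hc₂.trans (hc₁.trans ht₁))]
    exact pow_lt_pow_left₀ (mul_lt_mul_of_pos_left (pow_lt_pow_left₀ (hu.mul_lt hc₂.le he0)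
      zero_le hm) hhpos) zero_le hn
  · rw [map_mul, aeval_C, map_inv₀, map_mul W, map_inv₀, map_pow, map_pow,
      lt_inv_mul_iff₀ hrpos, mul_one, hr', hval c₁ (ht₂.trans (hc₂.trans hc₁)) ht₁]
    exact pow_lt_pow_left₀ (mul_lt_mul_of_pos_left (pow_lt_pow_left₀ (hu.lt_mul hc₁)
      zero_le hm) hhpos) zero_le hn

/-- Finitely many strict inequalities between values of polynomials at `x` also hold at two points
of residue field `k` which are separated by a polynomial. -/
theorem exists_two_perturbations [Algebra k L] [IsScalarTower k L M] [IsAlgClosed M]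
    (hu : IsInfinitesimalExtension v W u) {x : M}
    (hk : ∀ c : k, c ≠ 0 → v (algebraMap k M c) = 1)
    (hres : ∀ f ∈ L⟮x⟯, v f ≤ 1 → ∃ c : k, v (f - algebraMap k M c) < 1)
    (halg : Algebra.IsAlgebraic L⟮x⟯ M) (hx : Transcendental L x)
    (hnt : ∃ d : L, d ≠ 0 ∧ v (algebraMap L M d) < 1)
    (G : Finset (L[X] × L[X])) (hG : ∀ p ∈ G, p.1 ≠ 0 ∧ p.2 ≠ 0 ∧
      v (aeval x p.1) < v (aeval x p.2)) :
    ∃ y₁ y₂ : F, (∀ y ∈ ({y₁, y₂} : Set F), Transcendental L y ∧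
      (∀ f ∈ L⟮y⟯, W f ≤ 1 → ∃ c : k, W (f - algebraMap k F c) < 1) ∧
      ∀ p ∈ G, W (aeval y p.1) < W (aeval y p.2)) ∧
      ∃ P : L[X], W (aeval y₂ P) < 1 ∧ 1 < W (aeval y₁ P) := by
  classical
  obtain ⟨d, hd0, hd1⟩ := hnt
  let S : Finset M := G.biUnion fun p => (p.1.aroots M + p.2.aroots M).toFinset
  have hS : ∀ p ∈ G, ∀ b ∈ p.1.aroots M + p.2.aroots M, b ∈ S := fun p hp b hb =>
    Finset.mem_biUnion.2 ⟨p, hp, Multiset.mem_toFinset.2 hb⟩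
  have hSalg : ∀ b ∈ S, IsAlgebraic L b := by
    intro b hb
    obtain ⟨p, hp, hb⟩ := Finset.mem_biUnion.1 hb
    rcases Multiset.mem_add.1 (Multiset.mem_toFinset.1 hb) with h | h
    · exact ⟨p.1, (hG p hp).1, (mem_aroots.1 h).2⟩
    · exact ⟨p.2, (hG p hp).2.1, (mem_aroots.1 h).2⟩
  obtain ⟨a, ha, hne, hresa⟩ := v.exists_isAlgebraic_approximation hk hres halg hx S hSalg
  have hxa : x ≠ a := by rintro rfl; exact hx ha
  have hxa0 : 0 < v (x - a) := zero_lt_iff.2 ((Valuation.ne_zero_iff v).2 (sub_ne_zero.2 hxa))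
  have hb : ∀ p : L[X] × L[X], ∃ t : M, p ∈ G → t ≠ 0 ∧ IsAlgebraic L t ∧ ∀ t₁ t₂ : M,
      (∀ b ∈ p.1.aroots M + p.2.aroots M, v (x - a) < v (a - b) → v t₁ ≤ v (a - b)) →
      (∀ b ∈ p.1.aroots M + p.2.aroots M, v (a - b) ≤ v (x - a) → v (a - b) ≤ v t₂) →
      (v (x - a) < v t → v t₁ ≤ v t) → (v t ≤ v (x - a) → v t ≤ v t₂) →
      ∀ c, v t₂ < v c → v c < v t₁ →
        W (aeval (algebraMap M F a + algebraMap M F c * u) p.1) <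
          W (aeval (algebraMap M F a + algebraMap M F c * u) p.2) := by
    intro p
    by_cases hp : p ∈ G
    · obtain ⟨t, ht⟩ := exists_bound_of_lt hu ha hxa (hG p hp).1 (hG p hp).2.1
        (fun b hb => hne b (hS p hp b (Multiset.mem_add.2 (.inl hb))))
        (fun b hb => hne b (hS p hp b (Multiset.mem_add.2 (.inr hb)))) (hG p hp).2.2
      exact ⟨t, fun _ => ht⟩
    · exact ⟨0, fun h => absurd h hp⟩
  choose t ht using hb
  -- All the thresholds that the interval for `v c` must not cross: distances from `a` to the roots
  -- of the given polynomials and to the conjugates of `a`, and the bounds `t p` of the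
  -- inequalities.
  let T : Finset M := (((S ∪ ((minpoly L a).aroots M).toFinset).image fun b => a - b).filter
    (· ≠ 0)) ∪ G.image t
  have hT : ∀ t ∈ T, t ≠ 0 ∧ IsAlgebraic L t := by
    intro s hs
    simp only [T, Finset.mem_union, Finset.mem_filter, Finset.mem_image, Multiset.mem_toFinset]
      at hs
    obtain ⟨⟨b, hb, rfl⟩, h0⟩ | ⟨p, hp, rfl⟩ := hs
    · refine ⟨h0, ha.sub ?_⟩
      rcases hb with hb | hb
      · exact hSalg b hb
      · exact ⟨_, minpoly.ne_zero ha.isIntegral, (mem_aroots.1 hb).2⟩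
    · exact ⟨(ht p hp).1, (ht p hp).2.1⟩
  obtain ⟨t₁, t₂, ht₁0, ht₂0, ht₁, ht₂, hlt, hT1, hT2⟩ := v.exists_interval (L := L)
    (v (x - a)) T hT
    (d := algebraMap L M d) (by simpa) (isAlgebraic_algebraMap d) hd1
  have hroots : ∀ b ∈ S ∪ ((minpoly L a).aroots M).toFinset,
      (v (x - a) < v (a - b) → v t₁ ≤ v (a - b)) ∧ (v (a - b) ≤ v (x - a) → v (a - b) ≤ v t₂) := by
    intro b hb
    by_cases h0 : a - b = 0
    · simp [h0]
    · have : a - b ∈ T := Finset.mem_union_left _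
        (Finset.mem_filter.2 ⟨Finset.mem_image_of_mem _ hb, h0⟩)
      exact ⟨hT1 _ this, hT2 _ this⟩
  -- The separating value is that of an element algebraic over `L`, so that a power of it can be
  -- compared with values on `L`.
  obtain ⟨e, he, he2, he1⟩ := v.exists_between ht₂0 ht₁ ht₂ hlt
  have he0 : e ≠ 0 := (Valuation.ne_zero_iff v).1 (zero_le.trans_lt he2).ne'
  obtain ⟨c₁, -, hc₁e, hc₁t⟩ := v.exists_between he0 ht₁ he he1
  obtain ⟨c₂, -, hc₂t, hc₂e⟩ := v.exists_between ht₂0 he ht₂ he2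
  have hgood : ∀ c : M, v t₂ < v c → v c < v t₁ →
      Transcendental L (algebraMap M F a + algebraMap M F c * u) ∧
      (∀ f ∈ L⟮algebraMap M F a + algebraMap M F c * u⟯, W f ≤ 1 →
        ∃ c : k, W (f - algebraMap k F c) < 1) ∧
      ∀ p ∈ G, W (aeval (algebraMap M F a + algebraMap M F c * u) p.1) <
        W (aeval (algebraMap M F a + algebraMap M F c * u) p.2) := by
    intro c h2 h1
    have hc0 : c ≠ 0 := (Valuation.ne_zero_iff v).1 (zero_le.trans_lt h2).ne'
    refine ⟨transcendental_add_mul hu a hc0, exists_sub_lt_of_mem_adjoin_add_mul hu hc0 hresa,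
      fun p hp => ?_⟩
    have htT : t p ∈ T := Finset.mem_union_right _ (Finset.mem_image_of_mem t hp)
    exact (ht p hp).2.2 t₁ t₂ (fun b hb => (hroots b (Finset.mem_union_left _ (hS p hp b hb))).1)
      (fun b hb => (hroots b (Finset.mem_union_left _ (hS p hp b hb))).2)
      (hT1 _ htT) (hT2 _ htT) c h2 h1
  refine ⟨_, _, ?_, exists_separating_polynomial hu (x := x) ha he
    (fun b hb => (hroots b (Finset.mem_union_right _ (Multiset.mem_toFinset.2 hb))).1)
    (fun b hb => (hroots b (Finset.mem_union_right _ (Multiset.mem_toFinset.2 hb))).2)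
    hc₂t hc₂e hc₁e hc₁t⟩
  rintro y (rfl | rfl)
  · exact hgood c₁ (he2.trans hc₁e) hc₁t
  · exact hgood c₂ hc₂t (hc₂e.trans he1)

end InfinitesimalPerturbation

/-! ### From perturbed points to rational valuations of `L(x)`. -/

theorem exists_algHom_of_adjoin_eq_top {L K F : Type*} [Field L] [Field K] [Field F] [Algebra L K]
    [Algebra L F] {x : K} (hx : Transcendental L x) (htop : L⟮x⟯ = ⊤) {y : F}
    (hy : Transcendental L y) : ∃ φ : K →ₐ[L] F, φ x = y := by
  let e₁ : RatFunc L ≃ₐ[L] K := (RatFunc.algEquivOfTranscendental x hx).trans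
    ((equivOfEq htop).trans topEquiv)
  let e₂ : RatFunc L →ₐ[L] F := L⟮y⟯.val.comp (RatFunc.algEquivOfTranscendental y hy).toAlgHom
  have h₁ : e₁ RatFunc.X = x := by
    change ((RatFunc.algEquivOfTranscendental x hx RatFunc.X : L⟮x⟯) : K) = x
    simp
  refine ⟨e₂.comp e₁.symm.toAlgHom, ?_⟩
  have : e₁.symm x = RatFunc.X := by rw [← h₁, e₁.symm_apply_apply]
  change e₂ (e₁.symm x) = y
  rw [this]
  simp [e₂]

namespace ZariskiRiemann

variable {k L K : Type*} [Field k] [Field L] [Field K] [Algebra k L] [Algebra L K] [Algebra k K]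
  [IsScalarTower k L K]

/-- A nonconstant element of `L`, or its inverse, is integral; subtracting its residue gives `d`. So
the valuation is nontrivial on `L`. -/
theorem exists_valuation_lt_one {A : ZariskiRiemann K} (hA : A ∈ rational k K)
    (hL : ∃ z : L, z ∉ Set.range (algebraMap k L)) :
    ∃ d : L, d ≠ 0 ∧ A.valuation (algebraMap L K d) < 1 := by
  obtain ⟨z, hz⟩ := hL
  wlog hzA : algebraMap L K z ∈ A generalizing z
  · refine this z⁻¹ ?_ ?_
    · rintro ⟨c, hc⟩
      exact hz ⟨c⁻¹, by rw [map_inv₀, hc, inv_inv]⟩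
    · rw [map_inv₀]
      exact (A.mem_or_inv_mem _).resolve_left hzA
  obtain ⟨c, hc⟩ := (mem_rational_iff.1 hA).2 _ hzA
  refine ⟨z - algebraMap k L c, fun h0 => hz ⟨c, (sub_eq_zero.1 h0).symm⟩, ?_⟩
  rwa [map_sub, ← IsScalarTower.algebraMap_apply]

/-- Perturbation of a rational valuation of `K = L(x)`, where `L` is larger than the field of
constants. -/
theorem exists_rational_ne {x : K} (hx : Transcendental L x) (htop : L⟮x⟯ = ⊤)
    (hL : ∃ z : L, z ∉ Set.range (algebraMap k L)) {A : ZariskiRiemann K} (hA : A ∈ rational k K)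
    (G : Finset K) (hG : ∀ g ∈ G, A.valuation g < 1) :
    ∃ B ∈ rational k K, B ≠ A ∧ ∀ g ∈ G, B.valuation g < 1 := by
  classical
  let M := AlgebraicClosure K
  obtain ⟨V, hV⟩ := A.exists_comap_eq (algebraMap K M)
  obtain ⟨W, hW1, hW2, hW3⟩ := exists_infinitesimal_extension V
  have hu : IsInfinitesimalExtension V.valuation W.valuation (RatFunc.X : RatFunc M) := by
    refine ⟨fun z => ?_, hW2, fun d hd => ?_⟩
    · rw [RatFunc.algebraMap_eq_C]; exact hW1 z
    · rw [RatFunc.algebraMap_eq_C]; exact hW3 d hd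
  have hlt : ∀ z : K, V.valuation (algebraMap K M z) < 1 ↔ A.valuation z < 1 := fun z => by
    rw [← ValuationSubring.nonunits_comap, hV]
  have hle : ∀ z : K, V.valuation (algebraMap K M z) ≤ 1 ↔ A.valuation z ≤ 1 := fun z => by
    rw [V.valuation_le_one_iff, ← ValuationSubring.mem_comap, hV, A.valuation_le_one_iff]
  have hrep : ∀ z : K, ∃ P Q : L[X], z = aeval x P / aeval x Q := fun z =>
    (mem_adjoin_simple_iff L z).1 (htop ▸ mem_top)
  set x' : M := algebraMap K M x with hx'
  have haeval : ∀ P : L[X], aeval x' P = algebraMap K M (aeval x P) := fun P =>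
    aeval_algebraMap_apply M x P
  have hmem : ∀ z : K, algebraMap K M z ∈ L⟮x'⟯ := fun z => by
    obtain ⟨P, Q, rfl⟩ := hrep z
    exact (mem_adjoin_simple_iff L _).2 ⟨P, Q, by rw [map_div₀, haeval, haeval]⟩
  have hk : ∀ c : k, c ≠ 0 → V.valuation (algebraMap k M c) = 1 := by
    intro c hc
    have h1 := valuation_algebraMap_eq_one hA hc
    rw [IsScalarTower.algebraMap_apply k K M]
    exact le_antisymm ((hle _).2 h1.le) (not_lt.1 fun h => h1.not_lt ((hlt _).1 h))
  have hres : ∀ f ∈ L⟮x'⟯, V.valuation f ≤ 1 →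
      ∃ c : k, V.valuation (f - algebraMap k M c) < 1 := by
    intro f hf hf1
    obtain ⟨P, Q, rfl⟩ := (mem_adjoin_simple_iff L f).1 hf
    rw [haeval, haeval, ← map_div₀] at hf1 ⊢
    obtain ⟨c, hc⟩ := (mem_rational_iff.1 hA).2 _ ((A.valuation_le_one_iff _).1 ((hle _).1 hf1))
    refine ⟨c, ?_⟩
    rwa [IsScalarTower.algebraMap_apply k K M, ← map_sub, hlt]
  -- The image of `K = L(x)` in `M` lies in `L(x')`, so an equation over `K` becomes one over
  -- `L(x')`.
  have halg : Algebra.IsAlgebraic L⟮x'⟯ M := by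
    refine ⟨fun m => ?_⟩
    obtain ⟨q, hq0, hq⟩ := (AlgebraicClosure.isAlgebraic K).isAlgebraic m
    let g : K →+* L⟮x'⟯ := (algebraMap K M).codRestrict L⟮x'⟯.toSubring hmem
    refine ⟨q.map g, (Polynomial.map_ne_zero_iff g.injective).2 hq0, ?_⟩
    rw [aeval_def, eval₂_map, ← hq, aeval_def]
    rfl
  have hxM : Transcendental L x' := fun h => hx ((isAlgebraic_algebraMap_iff
    (algebraMap K M).injective).1 h)
  obtain ⟨d, hd0, hd⟩ := exists_valuation_lt_one hA hL
  choose P Q hPQ using hrep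
  -- Zero is left out, its numerator being possibly zero; it lies in every maximal ideal anyway.
  let G' : Finset (L[X] × L[X]) := (G.filter (· ≠ 0)).image fun g => (P g, Q g)
  have hG' : ∀ p ∈ G', p.1 ≠ 0 ∧ p.2 ≠ 0 ∧
      V.valuation (aeval x' p.1) < V.valuation (aeval x' p.2) := by
    intro p hp
    obtain ⟨g, hg, rfl⟩ := Finset.mem_image.1 hp
    obtain ⟨hgG, hg0⟩ := Finset.mem_filter.1 hg
    have hP0 : aeval x (P g) ≠ 0 := fun h => hg0 (by rw [hPQ g, h, zero_div])
    have hQ0 : aeval x (Q g) ≠ 0 := fun h => hg0 (by rw [hPQ g, h, div_zero])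
    refine ⟨fun (h : P g = 0) => hP0 (by rw [h, map_zero]),
      fun (h : Q g = 0) => hQ0 (by rw [h, map_zero]), ?_⟩
    have h1 := (hlt g).2 (hG g hgG)
    rw [hPQ g, map_div₀, map_div₀, div_lt_one₀ (zero_lt_iff.2 ((Valuation.ne_zero_iff _).2
      (by simpa using hQ0)))] at h1
    rwa [haeval, haeval]
  obtain ⟨y₁, y₂, hy, R, hR₂, hR₁⟩ := exists_two_perturbations hu hk hres halg hxM
    ⟨d, hd0, by rw [IsScalarTower.algebraMap_apply L K M]; exact (hlt _).2 hd⟩ G' hG'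
  have key : ∀ y ∈ ({y₁, y₂} : Set (RatFunc M)), ∃ B ∈ rational k K,
      (∀ g ∈ G, B.valuation g < 1) ∧ ∀ R : L[X], aeval x R ∈ B ↔ W.valuation (aeval y R) ≤ 1 := by
    intro y hyy
    obtain ⟨hytr, hyres, hyG⟩ := hy y hyy
    obtain ⟨φ, hφ⟩ := exists_algHom_of_adjoin_eq_top hx htop hytr
    have hφP : ∀ P : L[X], φ (aeval x P) = aeval y P := fun P => by
      rw [← hφ, aeval_algHom_apply]
    have hφmem : ∀ z : K, φ z ∈ L⟮y⟯ := fun z =>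
      (mem_adjoin_simple_iff L _).2 ⟨P z, Q z, by rw [← hφP, ← hφP, ← map_div₀, ← hPQ]⟩
    refine ⟨W.comap (φ.restrictScalars k).toRingHom, comap_mem_rational _ (fun c => ?_)
      (fun f hf => hyres _ (hφmem f) ((W.valuation_le_one_iff _).2 hf)), fun g hg => ?_,
      fun R => ?_⟩
    · rw [← W.valuation_le_one_iff, IsScalarTower.algebraMap_apply k M (RatFunc M), hu.le_one_iff]
      rcases eq_or_ne c 0 with rfl | hc
      · simp
      · exact (hk c hc).le
    · rw [ValuationSubring.nonunits_comap]
      change W.valuation (φ g) < 1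
      rcases eq_or_ne g 0 with rfl | hg0
      · simp
      have h1 := hyG (P g, Q g) (Finset.mem_image_of_mem _ (Finset.mem_filter.2 ⟨hg, hg0⟩))
      rw [hPQ g, map_div₀, hφP, hφP, map_div₀]
      exact (div_lt_one₀ (zero_le.trans_lt h1)).2 h1
    · rw [ValuationSubring.mem_comap, W.valuation_le_one_iff, ← hφP]
      rfl
  obtain ⟨B₁, hB₁, hB₁G, hB₁R⟩ := key y₁ (.inl rfl)
  obtain ⟨B₂, hB₂, hB₂G, hB₂R⟩ := key y₂ (.inr rfl)
  have hne : B₁ ≠ B₂ := by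
    rintro rfl
    exact hR₁.not_ge ((hB₁R R).1 ((hB₂R R).2 hR₂.le))
  by_cases h : B₁ = A
  · exact ⟨B₂, hB₂, fun h' => hne (h.trans h'.symm), hB₂G⟩
  · exact ⟨B₁, hB₁, h, hB₁G⟩

end ZariskiRiemann

/-! ### The field of rational functions. -/

namespace MvPolynomial

theorem countable_of_countable (σ k : Type*) [CommRing k] [Countable σ] [Countable k] :
    Countable (MvPolynomial σ k) := by
  rw [← Cardinal.mk_le_aleph0_iff]
  refine cardinalMk_le_max_lift.trans ?_
  simp [Cardinal.mk_le_aleph0]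

end MvPolynomial

/-- Over a countable field, the field of Laurent series has infinite transcendence degree. -/
theorem exists_algebraicIndependent_powerSeries (k : Type*) [Field k] [Countable k] (n : ℕ) :
    ∃ x : Fin n → FractionRing (PowerSeries k), AlgebraicIndependent k x := by
  obtain ⟨s, hs⟩ := exists_isTranscendenceBasis k (FractionRing (PowerSeries k))
  rcases finite_or_infinite s with hfin | hinf
  -- A finite transcendence basis would make the field countable, whereas the power series with
  -- coefficients `0` and `1` are uncountably many.
  · exfalso
    have h1 := MvPolynomial.countable_of_countable s k
    have h2 : Countable (Algebra.adjoin k (Set.range (Subtype.val : s → _))) :=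
      hs.1.aevalEquiv.symm.injective.countable
    have h3 := hs.isAlgebraic
    have h4 := Algebra.IsAlgebraic.cardinalMk_le_max
      (Algebra.adjoin k (Set.range (Subtype.val : s → FractionRing (PowerSeries k))))
      (FractionRing (PowerSeries k))
    rw [max_eq_right (Cardinal.mk_le_aleph0), Cardinal.mk_le_aleph0_iff] at h4
    have h5 : Countable (PowerSeries k) :=
      (IsFractionRing.injective (PowerSeries k) (FractionRing (PowerSeries k))).countable
    have h6 : Function.Injective fun S : Set ℕ =>
        (PowerSeries.mk (S.indicator 1) : PowerSeries k) := by
      intro S T h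
      ext i
      have := congrArg (PowerSeries.coeff i) h
      simp only [PowerSeries.coeff_mk] at this
      by_cases h1 : i ∈ S <;> by_cases h2 : i ∈ T <;> simp_all
    have h7 : Countable (Set ℕ) := h6.countable
    exact Function.cantor_surjective (fun i => (exists_surjective_nat (Set ℕ)).choose i)
      (exists_surjective_nat (Set ℕ)).choose_spec
  · exact ⟨_, hs.1.comp (fun i : Fin n => Infinite.natEmbedding s i)
      ((Infinite.natEmbedding s).injective.comp Fin.val_injective)⟩

namespace ZariskiRiemann

section

variable (k : Type*) [Field k] (n : ℕ)

theorem countable_rationalFunctionField [Countable k] :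
    Countable (RationalFunctionField k n) := by
  have := MvPolynomial.countable_of_countable (Fin n) k
  refine Function.Surjective.countable
    (f := fun p : MvPolynomial (Fin n) k × MvPolynomial (Fin n) k =>
      (algebraMap _ (RationalFunctionField k n) p.1 / algebraMap _ _ p.2)) fun z => ?_
  obtain ⟨p, q, -, h⟩ := IsFractionRing.div_surjective (A := MvPolynomial (Fin n) k) z
  exact ⟨(p, q), h⟩

/-- The `t`-adic valuation is pulled back along an embedding into the fraction field of the power
series; its residue map is the constant coefficient. -/
theorem rational_nonempty [Countable k] : (rational k (RationalFunctionField k n)).Nonempty := by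
  obtain ⟨x, hx⟩ := exists_algebraicIndependent_powerSeries k n
  let φ : RationalFunctionField k n →ₐ[k] FractionRing (PowerSeries k) :=
    IsFractionRing.liftAlgHom (g := MvPolynomial.aeval x) hx
  let V : ValuationSubring (FractionRing (PowerSeries k)) :=
    (ValuationRing.valuation (PowerSeries k) (FractionRing (PowerSeries k))).valuationSubring
  have hV : ∀ f, f ∈ V ↔ ∃ p : PowerSeries k, algebraMap _ _ p = f := fun f =>
    ValuationRing.mem_integer_iff (PowerSeries k) (FractionRing (PowerSeries k)) f
  refine ⟨V.comap φ.toRingHom, comap_mem_rational φ (fun c => ?_) fun f hf => ?_⟩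
  · exact (hV _).2 ⟨algebraMap k _ c, (IsScalarTower.algebraMap_apply _ _ _ _).symm⟩
  · obtain ⟨p, hp⟩ := (hV _).1 hf
    refine ⟨PowerSeries.constantCoeff p, ?_⟩
    rw [← hp, IsScalarTower.algebraMap_apply k (PowerSeries k) (FractionRing (PowerSeries k)),
      ← map_sub, ← ValuationSubring.mem_nonunits_iff, ValuationSubring.mem_nonunits_iff_or]
    by_contra! hcon
    obtain ⟨q, hq⟩ := (hV _).1 hcon.2
    have h1 : algebraMap (PowerSeries k) (FractionRing (PowerSeries k))
        (q * (p - algebraMap k _ (PowerSeries.constantCoeff p))) = algebraMap _ _ 1 := by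
      rw [map_mul, hq, inv_mul_cancel₀ hcon.1, map_one]
    have h2 := congrArg PowerSeries.constantCoeff
      (IsFractionRing.injective (PowerSeries k) (FractionRing (PowerSeries k)) h1)
    simp at h2

/-- The indeterminates of the field of rational functions. -/
noncomputable def indeterminate (i : Fin n) : RationalFunctionField k n :=
  algebraMap (MvPolynomial (Fin n) k) _ (MvPolynomial.X i)

theorem algebraicIndependent_indeterminate : AlgebraicIndependent k (indeterminate k n) :=
  (MvPolynomial.algebraicIndependent_X (Fin n) k).map'
    (f := IsScalarTower.toAlgHom k (MvPolynomial (Fin n) k) (RationalFunctionField k n))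
    (IsFractionRing.injective _ _)

/-- All indeterminates but one are put into `L`; as `n ≥ 2`, one of them remains there and makes `L`
larger than `k`. -/
theorem perfectSpace_rationalPatch_rationalFunctionField (hn : 2 ≤ n) :
    @PerfectSpace _ (rationalPatch k (RationalFunctionField k n)) := by
  let i₀ : Fin n := ⟨0, by omega⟩
  let i₁ : Fin n := ⟨1, by omega⟩
  have hind := algebraicIndependent_indeterminate k n
  let L : IntermediateField k (RationalFunctionField k n) :=
    adjoin k (indeterminate k n '' {i₀}ᶜ)
  have hmem : ∀ i, i ≠ i₀ → indeterminate k n i ∈ L := fun i hi =>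
    subset_adjoin k _ ⟨i, hi, rfl⟩
  have htr : Transcendental L (indeterminate k n i₀) :=
    transcendental_adjoin_iff.2 (hind.transcendental_adjoin (by simp))
  have htop : L⟮indeterminate k n i₀⟯ = ⊤ := by
    have hpoly : ∀ p : MvPolynomial (Fin n) k,
        algebraMap _ (RationalFunctionField k n) p ∈ L⟮indeterminate k n i₀⟯ := by
      intro p
      induction p using MvPolynomial.induction_on with
      | C c =>
        have : algebraMap (MvPolynomial (Fin n) k) (RationalFunctionField k n) (MvPolynomial.C c) =
            algebraMap L _ (algebraMap k L c) := by
          rw [← IsScalarTower.algebraMap_apply, ← MvPolynomial.algebraMap_eq,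
            ← IsScalarTower.algebraMap_apply]
        rw [this]
        exact _root_.algebraMap_mem _ _
      | add p q hp hq => rw [map_add]; exact add_mem hp hq
      | mul_X p i hp =>
        rw [map_mul]
        refine mul_mem hp ?_
        by_cases hi : i = i₀
        · subst hi
          exact mem_adjoin_simple_self L _
        · exact _root_.algebraMap_mem L⟮indeterminate k n i₀⟯ (⟨_, hmem i hi⟩ : L)
    refine eq_top_iff.2 fun z _ => ?_
    obtain ⟨p, q, -, rfl⟩ := IsFractionRing.div_surjective (A := MvPolynomial (Fin n) k) z
    exact div_mem (hpoly p) (hpoly q)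
  refine perfectSpace_rationalPatch fun A hA G hG =>
    exists_rational_ne (L := L) htr htop ⟨⟨_, hmem i₁ ?_⟩, ?_⟩ hA G hG
  · simp [i₀, i₁]
  · rintro ⟨c, hc⟩
    refine hind.transcendental i₁ ?_
    have hc' : algebraMap k (RationalFunctionField k n) c = indeterminate k n i₁ :=
      congrArg Subtype.val hc
    rw [← hc']
    exact isAlgebraic_algebraMap c

end

end ZariskiRiemann

theorem mainTheorem10 (n : ℕ) (hn : 2 ≤ n) (k : Type*) [Field k] [Countable k] :
    (@TotallyDisconnectedSpace (ZariskiRiemann.rational k (RationalFunctionField k n))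
        (ZariskiRiemann.rationalPatch k (RationalFunctionField k n)) ∧
      @PerfectSpace (ZariskiRiemann.rational k (RationalFunctionField k n))
        (ZariskiRiemann.rationalPatch k (RationalFunctionField k n)) ∧
      @TopologicalSpace.MetrizableSpace (ZariskiRiemann.rational k (RationalFunctionField k n))
        (ZariskiRiemann.rationalPatch k (RationalFunctionField k n))) ∧
    (Finite k →
      IsCantorSpace (ZariskiRiemann.rational k (RationalFunctionField k n))
        (ZariskiRiemann.rationalPatch k (RationalFunctionField k n)) ∧
      IsCantorSpace (ZariskiRiemann.rational k (RationalFunctionField k n))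
        (ZariskiRiemann.rationalZariski k (RationalFunctionField k n))) := by

  have := ZariskiRiemann.countable_rationalFunctionField k n
  have hp := ZariskiRiemann.perfectSpace_rationalPatch_rationalFunctionField k n hn
  refine ⟨⟨ZariskiRiemann.totallyDisconnectedSpace_rationalPatch _ _, hp,
    ZariskiRiemann.metrizableSpace_rationalPatch _ _⟩, fun hk => ?_⟩
  have hc := ZariskiRiemann.isCantorSpace_rationalPatch (ZariskiRiemann.rational_nonempty k n) hp
  refine ⟨hc, ?_⟩
  rw [ZariskiRiemann.rationalZariski_eq_rationalPatch]
  exact hc
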